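/- **Setting.** Let $N,M\in\mathbb N$. Consider the infinite-horizon problem of minimizing $J(\mathbf u)=\int_0^\infty r(\mathbf x(s))+\mathbf u(s)^\top R\,\mathbf u(s)\,ds$ over measurable controls $\mathbf u:[0,\infty)\to\mathbb R^M$, subject to $\dot{\mathbf x}=f(\mathbf x)+g(\mathbf x)\mathbf u$, $\mathbf x(0)=x_0$ (in the integrated, Carathéodory sense), where $f:\mathbb R^N\to\mathbb R^N$, $g:\mathbb R^N\to\mathbb R^{N\times M}$, $R\in\mathbb R^{M\times M}$ is symmetric positive definite, $r:\mathbb R^N\to[0,\infty)$ is continuous with $r^{-1}(\{0\})=\{0\}$, and $f(0)=0$. Let $v(x_0)\in[0,\infty]$ be the infimum of the cost over all such pairs $(\mathbf x,\mathbf u)$ with $\mathbf x(0)=x_0$; a pair attaining it is called an optimal process. Let $\mathcal A\subset\mathbb R^N$ be compact, and assume that for every $x_0\in\mathcal A$ there is an optimal process; write $\mathbf x^*(\cdot;x_0)$ for an optimal trajectory. Let $\mathcal T(\mathcal A)$ be the closure of the set of all states $\mathbf x^*(t;x_0)$ with $x_0\in\mathcal A$, $t\ge 0$, over all optimal processes,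 and for $\delta>0$ let $\mathcal T_\delta(\mathcal A)=\mathcal T(\mathcal A)+\overline{B_\delta}$, where $\overline{B_\delta}$ is the closed Euclidean ball of radius $\delta$ about $0$. **Algorithm 1** (greedy exploration, tolerance $\epsilon_d$). Start with $\mathcal D=\{0\}$ and $\epsilon=\epsilon_d+1$. While $\epsilon>\epsilon_d$: choose $x_a\in\mathcal A$ maximizing $\operatorname{dist}(\cdot,\mathcal D)$ over $\mathcal A$, set $\epsilon:=\operatorname{dist}(x_a,\mathcal D)$, and then add to $\mathcal D$ all states $\mathbf x^*(t;x_a)$, $t\ge0$, of an optimal trajectory from $x_a$. The output is $\mathcal D$. **Algorithm 2** (Hermite VKOGA for a kernel $k$, tolerance $\epsilon_f$). Start with $X=\emptyset$ and $s=0$, and let $e_s(x)=|v(x)-s(x)|+\|\nabla v(x)-\nabla s(x)\|_2$. While $e_s(x)>\epsilon_f$ for some $x\in\mathcal D\setminus X$: choose $x\in\mathcal D\setminus X$ maximizing $e_s$ over $\mathcal D\setminus X$, set $X:=X\cup\{x\}$, and let $s$ be a Hermite kernel interpolant on $X$, i.e. $s=\sum_{x_i\in X}\alpha_i k(x_i,\cdot)+\langle\beta_i,\nabla_1k(x_i,\cdot)\rangle$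 with $\alpha_i\in\mathbb R$, $\beta_i\in\mathbb R^N$ such that $s(x_i)=v(x_i)$ and $\nabla s(x_i)=\nabla v(x_i)$ for all $x_i\in X$. The output is $s$. **Theorem.** Let $\delta>0$ and $\Omega:=\mathcal T_\delta(\mathcal A)$. Assume that $k\in C^4(\operatorname{conv}(\Omega)\times\operatorname{conv}(\Omega))$ is a strictly positive definite kernel on $\Omega$, that $v(x)\to\infty$ as $\|x\|_2\to\infty$, that $v$ is finite on $\Omega$ and $v|_\Omega$ lies in the reproducing kernel Hilbert space $\mathcal H_k(\Omega)$, and that $f,g\in C^1(\Omega)$. Then for every $T>0$ there are constants $\overline C_T>0$ and $\tilde C_T>0$ such that the following holds for all tolerances $\epsilon_d,\epsilon_f\ge0$ with $\epsilon_d\overline C_T+\epsilon_f\tilde C_T<\delta$, every output $\mathcal D$ of Algorithm 1 terminated with tolerance $\epsilon_d$, and every output $s$ of Algorithm 2 terminated with data set $\mathcal D$ and tolerance $\epsilon_f$. For every $x_0\in\mathcal A$ the surrogate-controlled system $$\dot{\mathbf x}_s=f(\mathbf x_s)-\tfrac12\,g(\mathbf x_s)R^{-1}g(\mathbf x_s)^\top\nabla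 s(\mathbf x_s),\qquad \mathbf x_s(0)=x_0,$$ has a solution on $[0,T]$, and every optimal trajectory $\mathbf x^*(\cdot;x_0)$ and every such solution $\mathbf x_s(\cdot;x_0)$ satisfy $$\|\mathbf x^*(t;x_0)-\mathbf x_s(t;x_0)\|_2\le\epsilon_d\,\overline C_T+\epsilon_f\,\tilde C_T\qquad\text{for all }t\in[0,T].$$ In particular, $\overline C_T$ and $\tilde C_T$ do not depend on $\epsilon_d$, $\epsilon_f$, $\mathcal D$ or $s$. -/

import Mathlib

open MeasureTheory Set Filter Topology
open scoped ENNReal Pointwise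

noncomputable section

namespace HermiteControl

/-- Euclidean space `ℝⁿ`. -/
abbrev Vec (n : ℕ) : Type := EuclideanSpace ℝ (Fin n)

/-- Data of the infinite horizon problem: minimise `∫₀^∞ r(x) + uᵀ R u` subject to
`x' = f(x) + g(x) u`, where `R` is (symmetric) positive definite, `r` is continuous, nonnegative
and vanishes exactly at `0`, and `f(0) = 0`. -/
structure ControlProblem (N M : ℕ) where
  /-- drift -/
  f : Vec N → Vec N
  /-- control matrix -/
  g : Vec N → Matrix (Fin N) (Fin M) ℝ
  /-- running payoff -/
  r : Vec N → ℝ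
  /-- control weight -/
  R : Matrix (Fin M) (Fin M) ℝ
  R_posDef : R.PosDef
  r_continuous : Continuous r
  r_nonneg : ∀ x, 0 ≤ r x
  r_eq_zero_iff : ∀ x, r x = 0 ↔ x = 0
  f_zero : f 0 = 0

namespace ControlProblem

variable {N M : ℕ} (P : ControlProblem N M)

/-- `x` is a (Carathéodory) solution on `[0, ∞)` of `x' = f(x) + g(x) u`, `x(0) = x₀`, for the
measurable control `u`: the right-hand side is locally integrable and the integral equation holds.
Only the values at times `t ≥ 0` matter. -/
structure IsAdmissible (x₀ : Vec N) (x : ℝ → Vec N) (u : ℝ → Vec M) : Prop where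
  measurable_control : Measurable u
  integrable : ∀ t, 0 ≤ t →
    IntervalIntegrable (fun s => P.f (x s) + (P.g (x s)).toEuclideanLin (u s)) volume 0 t
  eq_integral : ∀ t, 0 ≤ t →
    x t = x₀ + ∫ s in (0 : ℝ)..t, (P.f (x s) + (P.g (x s)).toEuclideanLin (u s))

/-- The cost `∫₀^∞ r(x(s)) + u(s)ᵀ R u(s) ds ∈ [0, ∞]`. -/
def cost (x : ℝ → Vec N) (u : ℝ → Vec M) : ℝ≥0∞ :=
  ∫⁻ s in Ici (0 : ℝ), ENNReal.ofReal (P.r (x s) + inner ℝ (u s) (P.R.toEuclideanLin (u s)))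

/-- The value function, with values in `[0, ∞]`. -/
def value (x₀ : Vec N) : ℝ≥0∞ :=
  ⨅ (x : ℝ → Vec N) (u : ℝ → Vec M) (_ : P.IsAdmissible x₀ x u), P.cost x u

/-- The value function as a real function; meaningful where `P.value` is finite. -/
def v (x : Vec N) : ℝ := (P.value x).toReal

/-- `(x, u)` is an optimal process for the initial state `x₀`. -/
def IsOptimal (x₀ : Vec N) (x : ℝ → Vec N) (u : ℝ → Vec M) : Prop :=
  P.IsAdmissible x₀ x u ∧ P.cost x u = P.value x₀

/-- `𝒯(A)`: closure of the set of all states on optimal trajectories that start in `A`. -/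
def optimalStates (A : Set (Vec N)) : Set (Vec N) :=
  closure {y | ∃ x₀ ∈ A, ∃ x u, P.IsOptimal x₀ x u ∧ ∃ t : ℝ, 0 ≤ t ∧ x t = y}

/-- `𝒯_δ(A) = 𝒯(A) + closed ball of radius δ`. -/
def dilatedStates (A : Set (Vec N)) (δ : ℝ) : Set (Vec N) :=
  P.optimalStates A + Metric.closedBall (0 : Vec N) δ

/-- Right-hand side of the closed-loop system with feedback `-½ R⁻¹ g(x)ᵀ ∇s(x)`. -/
def closedLoop (s : Vec N → ℝ) (x : Vec N) : Vec N :=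
  P.f x + (P.g x).toEuclideanLin
    (-(1 / 2 : ℝ) • (P.R⁻¹ * (P.g x).transpose).toEuclideanLin (gradient s x))

/-- `xs` is a trajectory on `[0, T]` from `x₀` controlled by the surrogate `s`. -/
def IsSurrogateTrajectory (s : Vec N → ℝ) (T : ℝ) (x₀ : Vec N) (xs : ℝ → Vec N) : Prop :=
  xs 0 = x₀ ∧ ∀ t ∈ Icc 0 T, HasDerivWithinAt xs (P.closedLoop s (xs t)) (Icc 0 T) t

/-- Reachable loop states `(𝒟, ε)` of the greedy exploration algorithm with tolerance `tol`:
start with `𝒟 = {0}`, `ε = tol + 1`; while `ε > tol`, choose `xa ∈ A` farthest from `𝒟`, let `ε`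
be its distance to `𝒟` and add an optimal trajectory starting at `xa` to `𝒟`. -/
inductive GreedyReachable (A : Set (Vec N)) (tol : ℝ) : Set (Vec N) → ℝ → Prop
  | init : GreedyReachable A tol {0} (tol + 1)
  | step {D : Set (Vec N)} {ε : ℝ} {xa : Vec N} {x : ℝ → Vec N} {u : ℝ → Vec M}
      (prev : GreedyReachable A tol D ε) (continues : tol < ε) (mem : xa ∈ A)
      (argmax : ∀ y ∈ A, Metric.infDist y D ≤ Metric.infDist xa D)
      (optimal : P.IsOptimal xa x u) :
      GreedyReachable A tol (D ∪ x '' Ici 0) (Metric.infDist xa D)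

/-- `D` is an output of the greedy exploration algorithm, terminated with tolerance `tol`. -/
def IsGreedyOutput (A : Set (Vec N)) (tol : ℝ) (D : Set (Vec N)) : Prop :=
  ∃ ε, P.GreedyReachable A tol D ε ∧ ε ≤ tol

end ControlProblem

section Kernel

variable {N : ℕ}

/-- `φ ∈ ℋ_k(Ω)`: the restriction of `φ` to `Ω` is an element of a reproducing kernel Hilbert
space of real functions on `Ω` whose reproducing kernel is `k`. -/
def MemRKHS (Ω : Set (Vec N)) (k : Vec N → Vec N → ℝ) (φ : Vec N → ℝ) : Prop :=
  ∃ (H : Type) (_ : NormedAddCommGroup H) (_ : InnerProductSpace ℝ H) (_ : CompleteSpace H)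
    (_ : RKHS ℝ H Ω ℝ),
    (∀ x y : Ω, RKHS.kernel H x y (1 : ℝ) = k x y) ∧ ∃ h : H, ∀ x : Ω, h x = φ x

/-- `k` is a strictly positive definite (symmetric) kernel on `Ω`: all Gram matrices of finitely
many distinct points are positive definite. -/
def IsSPDKernel (Ω : Set (Vec N)) (k : Vec N → Vec N → ℝ) : Prop :=
  (Matrix.of fun x y : Ω => k x y).PosDef

/-- The function `∑ᵢ αᵢ k(xᵢ, ·) + ⟨βᵢ, ∇₁ k(xᵢ, ·)⟩` with centers `xᵢ ∈ X`. -/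
def hermiteSum (k : Vec N → Vec N → ℝ) (X : Finset (Vec N)) (α : Vec N → ℝ)
    (β : Vec N → Vec N) (x : Vec N) : ℝ :=
  ∑ y ∈ X, (α y * k y x + inner ℝ (β y) (gradient (fun z => k z x) y))

/-- `s` is the Hermite kernel interpolant of `v` with centers `X`. -/
def IsHermiteInterpolant (k : Vec N → Vec N → ℝ) (v : Vec N → ℝ) (X : Finset (Vec N))
    (s : Vec N → ℝ) : Prop :=
  (∃ (α : Vec N → ℝ) (β : Vec N → Vec N), s = hermiteSum k X α β) ∧
    ∀ y ∈ X, s y = v y ∧ gradient s y = gradient v y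

/-- `|v(x) - s(x)| + ‖∇v(x) - ∇s(x)‖`. -/
def hermiteError (v s : Vec N → ℝ) (x : Vec N) : ℝ :=
  |v x - s x| + ‖gradient v x - gradient s x‖

/-- Reachable loop states `(X, s)` of the Hermite VKOGA with data `D`, `v(D)`, `∇v(D)` and
tolerance `tol`: start with `X = ∅`, `s = 0`; while some point of `D \ X` has error greater than
`tol`, add a point of `D \ X` with maximal error to `X` and interpolate on the new `X`. -/
inductive VKOGAReachable (k : Vec N → Vec N → ℝ) (v : Vec N → ℝ) (D : Set (Vec N)) (tol : ℝ) :
    Finset (Vec N) → (Vec N → ℝ) → Prop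
  | init : VKOGAReachable k v D tol ∅ 0
  | step {X : Finset (Vec N)} {s s' : Vec N → ℝ} {x : Vec N}
      (prev : VKOGAReachable k v D tol X s) (mem : x ∈ D) (notMem : x ∉ X)
      (continues : tol < hermiteError v s x)
      (argmax : ∀ y ∈ D, y ∉ X → hermiteError v s y ≤ hermiteError v s x)
      (interp : IsHermiteInterpolant k v (X.cons x notMem) s') :
      VKOGAReachable k v D tol (X.cons x notMem) s'

/-- `s` is an output of the Hermite VKOGA, terminated with tolerance `tol`. -/
def IsVKOGAOutput (k : Vec N → Vec N → ℝ) (v : Vec N → ℝ) (D : Set (Vec N)) (tol : ℝ)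
    (s : Vec N → ℝ) : Prop :=
  ∃ X, VKOGAReachable k v D tol X s ∧ ∀ x ∈ D, x ∉ X → hermiteError v s x ≤ tol

end Kernel

/-- The RKHS assumption on `Ω`: `k` is a strictly positive definite kernel of class `C⁴` on
`conv Ω × conv Ω`, and the value function is radially unbounded, finite on `Ω`, and belongs to
`ℋ_k(Ω)`. -/
structure RKHSAssumption {N M : ℕ} (P : ControlProblem N M) (Ω : Set (Vec N))
    (k : Vec N → Vec N → ℝ) : Prop where
  spd : IsSPDKernel Ω k
  smooth : ContDiffOn ℝ 4 (fun p : Vec N × Vec N => k p.1 p.2)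
    (convexHull ℝ Ω ×ˢ convexHull ℝ Ω)
  radially_unbounded : Tendsto P.value (cocompact (Vec N)) (𝓝 ⊤)
  finite : ∀ x ∈ Ω, P.value x ≠ ⊤
  mem : MemRKHS Ω k P.v

end HermiteControl

end

/-! The difficulty is uniformity: the constants must not depend on the data set or on the surrogate.
Write `v x = ⟪Φ x, h⟫` with the feature map `Φ` of the kernel. A kernel of class C⁴ makes `Φ` of
class C² on the interior of Ω. The Hermite conditions say that `h - h'` is orthogonal to all `Φ y`
and to the ranges of the derivatives of `Φ` at the centers `y`, whose span contains the representer
`h'` of the surrogate. Hence `‖h'‖ ≤ ‖h‖` for every set of centers. The closed-loop field belonging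
to `h'` is `f x + C x h'` with `C` of class C¹, so on a compact tube around the optimal states all
surrogate fields share one Lipschitz constant.

Optimal trajectories solve the closed-loop equation of `v`: dynamic programming gives the
Hamilton-Jacobi-Bellman inequality for every control and equality almost everywhere along an optimal
process. The optimal control therefore minimizes a strictly convex quadratic, which determines it
(`eq_feedback_of_isMinimizer`, `IsOptimal.hasDerivWithinAt`).

The greedy data set consists of 0 and entire optimal trajectories, so from almost within distance
`εd` of `x₀` there starts a solution `z` of the exact closed loop that never leaves the data. Along
`z` the gradient error is at most `εf`. Grönwall compares both the surrogate solution and the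
optimal trajectory with `z`, and the triangle inequality concludes
(`exists_solution_and_norm_sub_le`). The smallness condition keeps the curves inside the tube, which
also yields existence on `[0, T]`. -/

noncomputable section

namespace HermiteControl

/-! ### Regularity of feature maps of smooth kernels -/

section FeatureMap

variable {E H : Type*} [NormedAddCommGroup E] [NormedSpace ℝ E]
  [NormedAddCommGroup H] [InnerProductSpace ℝ H]

/-- The mixed second difference of a `C²` function is its mixed second derivative up to
an error that is small in both increments. -/
theorem exists_abs_mixed_difference_sub_le {k : E × E → ℝ} {x : E}
    (hk : ContDiffAt ℝ 2 k (x, x)) {ε : ℝ} (hε : 0 < ε) :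
    ∃ ρ > 0, ∀ y ∈ Metric.ball x ρ, ∀ z ∈ Metric.ball x ρ,
      |(k (y, z) - k (x, z)) - (k (y, x) - k (x, x))
        - fderiv ℝ (fderiv ℝ k) (x, x) (y - x, 0) (0, z - x)| ≤ ε * ‖y - x‖ * ‖z - x‖ := by
  have h1 : ContDiffAt ℝ 1 (fderiv ℝ k) (x, x) := hk.fderiv_right (by norm_num)
  have hs := h1.hasStrictFDerivAt (by norm_num)
  have hlo := (hs.isLittleO.def hε)
  have hd : ∀ᶠ p in 𝓝 (x, x), DifferentiableAt ℝ k p := by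
    filter_upwards [hk.eventually (by simp)] with p hp
    exact hp.differentiableAt (by norm_num)
  obtain ⟨ρ₁, hρ₁, h₁⟩ := Metric.eventually_nhds_iff_ball.1 hlo
  obtain ⟨ρ₂, hρ₂, h₂⟩ := Metric.eventually_nhds_iff_ball.1 hd
  refine ⟨min ρ₁ ρ₂, lt_min hρ₁ hρ₂, fun y hy z hz => ?_⟩
  have hx : x ∈ Metric.ball x (min ρ₁ ρ₂) := Metric.mem_ball_self (lt_min hρ₁ hρ₂)
  have hball : ∀ a ∈ Metric.ball x (min ρ₁ ρ₂), ∀ b ∈ Metric.ball x (min ρ₁ ρ₂),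
      (a, b) ∈ Metric.ball (x, x) (min ρ₁ ρ₂) := by
    intro a ha b hb
    rw [← ball_prod_same]
    exact ⟨ha, hb⟩
  set c := fderiv ℝ (fderiv ℝ k) (x, x) with hc
  -- The mean value inequality in the second variable supplies the factor `‖z - x‖`; strict
  -- differentiability of `fderiv ℝ k` at `(x, x)`, applied to the pair `(y, w)`, `(x, w)`, supplies
  -- the factor `‖y - x‖`.
  let ψ : E → ℝ := fun w => k (y, w) - k (x, w) - c (y - x, 0) (0, w - x)
  let ψ' : E → E →L[ℝ] ℝ := fun w =>
    (fderiv ℝ k (y, w) - fderiv ℝ k (x, w) - c (y - x, 0)).comp (ContinuousLinearMap.inr ℝ E E)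
  have hderiv : ∀ w ∈ Metric.ball x (min ρ₁ ρ₂),
      HasFDerivWithinAt ψ (ψ' w) (Metric.ball x (min ρ₁ ρ₂)) w := by
    intro w hw
    have key : ∀ a ∈ Metric.ball x (min ρ₁ ρ₂), HasFDerivAt (fun w => k (a, w))
        ((fderiv ℝ k (a, w)).comp (ContinuousLinearMap.inr ℝ E E)) w := by
      intro a ha
      have hp := (h₂ (a, w) (Metric.ball_subset_ball (min_le_right _ _) (hball a ha w hw)))
      exact hp.hasFDerivAt.comp w (hasFDerivAt_prodMk_right a w)
    have hlin : HasFDerivAt (fun w => c (y - x, 0) (0, w - x))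
        ((c (y - x, 0)).comp (ContinuousLinearMap.inr ℝ E E)) w := by
      have := ((c (y - x, 0)).comp (ContinuousLinearMap.inr ℝ E E)).hasFDerivAt (x := w - x)
      exact HasFDerivAt.comp (g := (c (y - x, 0)).comp (ContinuousLinearMap.inr ℝ E E))
        (f := fun w => w - x) (f' := .id ℝ E) w this ((hasFDerivAt_id w).sub_const x)
    have := ((key y hy).sub (key x hx)).sub hlin
    simp only [ψ', ContinuousLinearMap.sub_comp]
    exact this.hasFDerivWithinAt
  have hbound : ∀ w ∈ Metric.ball x (min ρ₁ ρ₂), ‖ψ' w‖ ≤ ε * ‖y - x‖ := by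
    intro w hw
    have hm : ((y, w), (x, w)) ∈ Metric.ball ((x, x), (x, x)) ρ₁ := by
      rw [← ball_prod_same]
      exact ⟨Metric.ball_subset_ball (min_le_left _ _) (hball y hy w hw),
        Metric.ball_subset_ball (min_le_left _ _) (hball x hx w hw)⟩
    have := h₁ _ hm
    have hinr : ‖ContinuousLinearMap.inr ℝ E E‖ ≤ 1 :=
      ContinuousLinearMap.norm_inr_le_one ℝ E E
    calc ‖ψ' w‖ ≤ ‖fderiv ℝ k (y, w) - fderiv ℝ k (x, w) - c (y - x, 0)‖ *
          ‖ContinuousLinearMap.inr ℝ E E‖ := ContinuousLinearMap.opNorm_comp_le _ _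
      _ ≤ ‖fderiv ℝ k (y, w) - fderiv ℝ k (x, w) - c (y - x, 0)‖ * 1 := by gcongr
      _ ≤ ε * ‖y - x‖ := by
        simpa [Prod.norm_def, hc] using this
  have := (convex_ball x (min ρ₁ ρ₂)).norm_image_sub_le_of_norm_hasFDerivWithin_le
    hderiv hbound hx hz
  simp only [ψ, sub_self, Real.norm_eq_abs] at this
  have h0 : (c (y - x, 0)) ((0 : E), (0 : E)) = 0 := (c (y - x, 0)).map_zero
  rw [h0] at this
  convert this using 2
  ring

/-- Differentiate `⟪Φ y, Φ z⟫ = k (y, z)` once in each variable. Thus each directional derivative of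
`Φ` is again a feature map, of a mixed derivative of `k`, which permits bootstrapping. -/
theorem inner_fderiv_fderiv_eq {Φ : E → H} {k : E × E → ℝ} {U : Set E} (hU : IsOpen U)
    (hΦ : ∀ y ∈ U, ∀ z ∈ U, inner ℝ (Φ y) (Φ z) = k (y, z)) (hd : DifferentiableOn ℝ Φ U)
    {x y : E} (hx : x ∈ U) (hy : y ∈ U) (e e' : E) (hk : ContDiffOn ℝ 2 k (U ×ˢ U)) :
    inner ℝ (fderiv ℝ Φ x e) (fderiv ℝ Φ y e') =
      fderiv ℝ (fun p => fderiv ℝ k p (e, 0)) (x, y) (0, e') := by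
  have hUU : IsOpen (U ×ˢ U) := hU.prod hU
  have hkd : ∀ p ∈ U ×ˢ U, DifferentiableAt ℝ k p := fun p hp =>
    (hk.contDiffAt (hUU.mem_nhds hp)).differentiableAt (by norm_num)
  have h1 : ∀ z ∈ U, inner ℝ (fderiv ℝ Φ x e) (Φ z) = fderiv ℝ k (x, z) (e, 0) := by
    intro z hz
    have hl : HasFDerivAt (fun w => inner ℝ (Φ z) (Φ w))
        ((innerSL ℝ (Φ z)).comp (fderiv ℝ Φ x)) x :=
      (innerSL ℝ (Φ z)).hasFDerivAt.comp x (hd.differentiableAt (hU.mem_nhds hx)).hasFDerivAt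
    have hr : HasFDerivAt (fun w => k (w, z))
        ((fderiv ℝ k (x, z)).comp (ContinuousLinearMap.inl ℝ E E)) x :=
      (hkd (x, z) ⟨hx, hz⟩).hasFDerivAt.comp x (hasFDerivAt_prodMk_left x z)
    have he : (fun w => inner ℝ (Φ z) (Φ w)) =ᶠ[𝓝 x] fun w => k (w, z) := by
      filter_upwards [hU.mem_nhds hx] with w hw
      rw [real_inner_comm, hΦ w hw z hz]
    have := congrArg (fun L => L e) (hl.unique (hr.congr_of_eventuallyEq he))
    simpa [real_inner_comm] using this
  have hk' : DifferentiableAt ℝ (fun p => fderiv ℝ k p (e, 0)) (x, y) :=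
    (((hk.contDiffAt (hUU.mem_nhds ⟨hx, hy⟩)).fderiv_right (m := 1)
      (by norm_num)).differentiableAt (by norm_num)).clm_apply (differentiableAt_const _)
  have hl : HasFDerivAt (fun w => inner ℝ (fderiv ℝ Φ x e) (Φ w))
      ((innerSL ℝ (fderiv ℝ Φ x e)).comp (fderiv ℝ Φ y)) y :=
    (innerSL ℝ (fderiv ℝ Φ x e)).hasFDerivAt.comp y
      (hd.differentiableAt (hU.mem_nhds hy)).hasFDerivAt
  have hr : HasFDerivAt (fun w => fderiv ℝ k (x, w) (e, 0))
      ((fderiv ℝ (fun p => fderiv ℝ k p (e, 0)) (x, y)).comp (ContinuousLinearMap.inr ℝ E E)) y :=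
    hk'.hasFDerivAt.comp y (hasFDerivAt_prodMk_right x y)
  have he : (fun w => inner ℝ (fderiv ℝ Φ x e) (Φ w)) =ᶠ[𝓝 y]
      fun w => fderiv ℝ k (x, w) (e, 0) := by
    filter_upwards [hU.mem_nhds hy] with w hw using h1 w hw
  have := congrArg (fun L => L e') (hl.unique (hr.congr_of_eventuallyEq he))
  simpa using this

theorem contDiffOn_mixed_fderiv {k : E × E → ℝ} {V : Set (E × E)} (hV : IsOpen V) {m n : ℕ}
    (hmn : m + 2 ≤ n) (hk : ContDiffOn ℝ n k V) (e e' : E) :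
    ContDiffOn ℝ m (fun p => fderiv ℝ (fun p => fderiv ℝ k p (e, 0)) p (0, e')) V := by
  have h1 : ContDiffOn ℝ (m + 1 : ℕ) (fun p => fderiv ℝ k p (e, 0)) V :=
    (hk.fderiv_of_isOpen hV (by exact_mod_cast hmn)).clm_apply contDiffOn_const
  exact (h1.fderiv_of_isOpen hV (by norm_cast)).clm_apply contDiffOn_const

variable [FiniteDimensional ℝ E] [CompleteSpace H]

/-- A feature map of a `C²` kernel is differentiable. -/
theorem differentiableAt_of_inner_eq {Φ : E → H} {k : E × E → ℝ} {x : E} {U : Set E}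
    (hU : U ∈ 𝓝 x) (hΦ : ∀ y ∈ U, ∀ z ∈ U, inner ℝ (Φ y) (Φ z) = k (y, z))
    (hk : ContDiffAt ℝ 2 k (x, x)) : DifferentiableAt ℝ Φ x := by
  set c : E → E → ℝ := fun y z => fderiv ℝ (fderiv ℝ k) (x, x) (y, 0) (0, z) with hc
  have cadd₁ : ∀ a b z, c (a + b) z = c a z + c b z := fun a b z => by
    have : ((a + b, 0) : E × E) = (a, 0) + (b, 0) := by simp
    simp only [hc, this, map_add, add_apply]
  have cadd₂ : ∀ z a b, c z (a + b) = c z a + c z b := fun z a b => by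
    have : ((0, a + b) : E × E) = (0, a) + (0, b) := by simp
    simp only [hc, this, map_add]
  have csmul₁ : ∀ (τ : ℝ) a z, c (τ • a) z = τ * c a z := fun τ a z => by
    have : ((τ • a, 0) : E × E) = τ • (a, 0) := by simp
    simp only [hc, this, map_smul, smul_apply, smul_eq_mul]
  have csmul₂ : ∀ (τ : ℝ) z a, c z (τ • a) = τ * c z a := fun τ z a => by
    have : ((0, τ • a) : E × E) = τ • (0, a) := by simp
    simp only [hc, this, map_smul, smul_eq_mul]
  have hmixed : ∀ ε > 0, ∃ ρ > 0, ∀ y ∈ Metric.ball x ρ, ∀ z ∈ Metric.ball x ρ,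
      |inner ℝ (Φ y - Φ x) (Φ z - Φ x) - c (y - x) (z - x)| ≤ ε * ‖y - x‖ * ‖z - x‖ := by
    intro ε hε
    obtain ⟨ρ₁, hρ₁, h₁⟩ := exists_abs_mixed_difference_sub_le hk hε
    obtain ⟨ρ₂, hρ₂, h₂⟩ := Metric.mem_nhds_iff.1 hU
    refine ⟨min ρ₁ ρ₂, lt_min hρ₁ hρ₂, fun y hy z hz => ?_⟩
    have hyU := h₂ (Metric.ball_subset_ball (min_le_right _ _) hy)
    have hzU := h₂ (Metric.ball_subset_ball (min_le_right _ _) hz)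
    have hxU := mem_of_mem_nhds hU
    have := h₁ y (Metric.ball_subset_ball (min_le_left _ _) hy) z
      (Metric.ball_subset_ball (min_le_left _ _) hz)
    rw [inner_sub_left, inner_sub_right, inner_sub_right, hΦ y hyU z hzU, hΦ y hyU x hxU,
      hΦ x hxU z hzU, hΦ x hxU x hxU]
    convert this using 2
    ring
  -- Inner products of difference quotients are mixed differences of `k`, hence converge to values
  -- of `c`. This yields strong limits without any compactness in `H`.
  let Q : E → ℝ → H := fun e τ => τ⁻¹ • (Φ (x + τ • e) - Φ x)
  have hnear : ∀ (e : E) (ρ : ℝ), 0 < ρ → ∀ᶠ τ in 𝓝[≠] (0 : ℝ), x + τ • e ∈ Metric.ball x ρ := by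
    intro e ρ hρ
    have : Tendsto (fun τ : ℝ => x + τ • e) (𝓝[≠] 0) (𝓝 x) := by
      have : Continuous (fun τ : ℝ => x + τ • e) := by fun_prop
      have h := this.tendsto 0
      simp only [zero_smul, add_zero] at h
      exact h.mono_left nhdsWithin_le_nhds
    exact this (Metric.ball_mem_nhds x hρ)
  have hQz : ∀ ε > 0, ∃ ρ > 0, ∀ e, ∀ᶠ τ in 𝓝[≠] (0 : ℝ), ∀ z ∈ Metric.ball x ρ,
      |inner ℝ (Q e τ) (Φ z - Φ x) - c e (z - x)| ≤ ε * ‖e‖ * ‖z - x‖ := by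
    intro ε hε
    obtain ⟨ρ, hρ, h⟩ := hmixed ε hε
    refine ⟨ρ, hρ, fun e => ?_⟩
    filter_upwards [hnear e ρ hρ, self_mem_nhdsWithin] with τ hτ hτ0 z hz
    have hτ0 : τ ≠ 0 := hτ0
    have := h _ hτ z hz
    simp only [add_sub_cancel_left, csmul₁, norm_smul] at this
    have e1 : inner ℝ (Q e τ) (Φ z - Φ x) - c e (z - x)
        = τ⁻¹ * (inner ℝ (Φ (x + τ • e) - Φ x) (Φ z - Φ x) - τ * c e (z - x)) := by
      simp only [Q, real_inner_smul_left]
      field_simp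
    rw [e1, abs_mul]
    have hτ' : 0 < |τ| := abs_pos.2 hτ0
    calc |τ⁻¹| * |inner ℝ (Φ (x + τ • e) - Φ x) (Φ z - Φ x) - τ * c e (z - x)|
        ≤ |τ⁻¹| * (ε * (‖τ‖ * ‖e‖) * ‖z - x‖) := by gcongr
      _ = ε * ‖e‖ * ‖z - x‖ := by
        rw [abs_inv, Real.norm_eq_abs]; field_simp
  have hQQ : ∀ ε > 0, ∀ e e', ∀ᶠ τ in 𝓝[≠] (0 : ℝ), ∀ᶠ σ in 𝓝[≠] (0 : ℝ),
      |inner ℝ (Q e τ) (Q e' σ) - c e e'| ≤ ε * ‖e‖ * ‖e'‖ := by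
    intro ε hε e e'
    obtain ⟨ρ, hρ, h⟩ := hQz ε hε
    filter_upwards [h e] with τ hτ
    filter_upwards [hnear e' ρ hρ, self_mem_nhdsWithin] with σ hσ hσ0
    have hσ0 : σ ≠ 0 := hσ0
    have := hτ _ hσ
    simp only [add_sub_cancel_left, csmul₂, norm_smul] at this
    have e1 : inner ℝ (Q e τ) (Q e' σ) - c e e'
        = σ⁻¹ * (inner ℝ (Q e τ) (Φ (x + σ • e') - Φ x) - σ * c e e') := by
      simp only [Q, real_inner_smul_right]
      field_simp
    rw [e1, abs_mul]
    have hτ' : 0 < |σ| := abs_pos.2 hσ0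
    calc |σ⁻¹| * |inner ℝ (Q e τ) (Φ (x + σ • e') - Φ x) - σ * c e e'|
        ≤ |σ⁻¹| * (ε * ‖e‖ * (‖σ‖ * ‖e'‖)) := by gcongr
      _ = ε * ‖e‖ * ‖e'‖ := by
        rw [abs_inv, Real.norm_eq_abs]; field_simp
  have hcauchy : ∀ e, ∃ a, Tendsto (Q e) (𝓝[≠] 0) (𝓝 a) := by
    intro e
    refine cauchy_map_iff_exists_tendsto.1 (Metric.cauchy_iff.2 ⟨inferInstance, fun ε hε => ?_⟩)
    -- The square of `‖Q e τ - Q e σ‖` combines three inner products with total weight 4, each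
    -- within `ε' * ‖e‖ * ‖e‖` of `c e e`, and the main terms cancel.
    obtain ⟨ε', hε', hlt⟩ : ∃ ε' > 0, 4 * (ε' * ‖e‖ * ‖e‖) < ε ^ 2 := by
      refine ⟨ε ^ 2 / (8 * (‖e‖ * ‖e‖ + 1)), by positivity, ?_⟩
      have : 0 < ‖e‖ * ‖e‖ + 1 := by positivity
      rw [show 4 * (ε ^ 2 / (8 * (‖e‖ * ‖e‖ + 1)) * ‖e‖ * ‖e‖)
        = (ε ^ 2 / 2) * ((‖e‖ * ‖e‖) / (‖e‖ * ‖e‖ + 1)) by field_simp; ring]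
      have h1 : (‖e‖ * ‖e‖) / (‖e‖ * ‖e‖ + 1) ≤ 1 := by rw [div_le_one this]; linarith
      nlinarith [sq_pos_of_pos hε]
    obtain ⟨ρ, hρ, h⟩ := hmixed ε' hε'
    have hq : ∀ τ σ : ℝ, τ ≠ 0 → σ ≠ 0 → x + τ • e ∈ Metric.ball x ρ →
        x + σ • e ∈ Metric.ball x ρ →
        |inner ℝ (Q e τ) (Q e σ) - c e e| ≤ ε' * ‖e‖ * ‖e‖ := by
      intro τ σ hτ hσ h1 h2
      have := h _ h1 _ h2
      simp only [add_sub_cancel_left, csmul₁, csmul₂, norm_smul] at this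
      have e1 : inner ℝ (Q e τ) (Q e σ) - c e e = τ⁻¹ * σ⁻¹ *
          (inner ℝ (Φ (x + τ • e) - Φ x) (Φ (x + σ • e) - Φ x) - σ * (τ * c e e)) := by
        simp only [Q, real_inner_smul_right, real_inner_smul_left]
        field_simp
      have hτ' : 0 < |τ| := abs_pos.2 hτ
      have hσ' : 0 < |σ| := abs_pos.2 hσ
      rw [e1, abs_mul]
      have e2 : σ * (τ * c e e) = τ * (σ * c e e) := by ring
      calc _ ≤ |τ⁻¹ * σ⁻¹| * (ε' * (‖τ‖ * ‖e‖) * (‖σ‖ * ‖e‖)) := by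
            gcongr
            first | exact this | (rw [e2]; exact this)
        _ = ε' * ‖e‖ * ‖e‖ := by
          rw [abs_mul, abs_inv, abs_inv, Real.norm_eq_abs, Real.norm_eq_abs]; field_simp
    refine ⟨Q e '' {τ | x + τ • e ∈ Metric.ball x ρ ∧ τ ≠ 0}, ?_, ?_⟩
    · refine image_mem_map ?_
      filter_upwards [hnear e ρ hρ, self_mem_nhdsWithin] with τ h1 h2
      exact ⟨h1, h2⟩
    · rintro _ ⟨τ, ⟨hτ, hτ0⟩, rfl⟩ _ ⟨σ, ⟨hσ, hσ0⟩, rfl⟩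
      have h1 := abs_le.1 (hq τ τ hτ0 hτ0 hτ hτ)
      have h2 := abs_le.1 (hq τ σ hτ0 hσ0 hτ hσ)
      have h3 := abs_le.1 (hq σ σ hσ0 hσ0 hσ hσ)
      rw [dist_eq_norm]
      have h4 := norm_sub_sq_real (Q e τ) (Q e σ)
      rw [← real_inner_self_eq_norm_sq (Q e τ), ← real_inner_self_eq_norm_sq (Q e σ)] at h4
      refine lt_of_pow_lt_pow_left₀ 2 hε.le ?_
      linarith [h1.1, h1.2]
  choose a ha using hcauchy
  have haz : ∀ ε > 0, ∃ ρ > 0, ∀ e, ∀ z ∈ Metric.ball x ρ,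
      |inner ℝ (a e) (Φ z - Φ x) - c e (z - x)| ≤ ε * ‖e‖ * ‖z - x‖ := by
    intro ε hε
    obtain ⟨ρ, hρ, h⟩ := hQz ε hε
    refine ⟨ρ, hρ, fun e z hz => ?_⟩
    have ht : Tendsto (fun τ => |inner ℝ (Q e τ) (Φ z - Φ x) - c e (z - x)|) (𝓝[≠] 0)
        (𝓝 |inner ℝ (a e) (Φ z - Φ x) - c e (z - x)|) :=
      (((ha e).inner tendsto_const_nhds).sub_const _).abs
    exact le_of_tendsto ht ((h e).mono fun τ hτ => hτ z hz)
  have haa : ∀ e e', inner ℝ (a e) (a e') = c e e' := by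
    intro e e'
    have key : ∀ ε > 0, |inner ℝ (a e) (a e') - c e e'| ≤ ε * ‖e‖ * ‖e'‖ := by
      intro ε hε
      have ht : Tendsto (fun τ => |inner ℝ (Q e τ) (a e') - c e e'|) (𝓝[≠] 0)
          (𝓝 |inner ℝ (a e) (a e') - c e e'|) :=
        (((ha e).inner tendsto_const_nhds).sub_const _).abs
      refine le_of_tendsto ht ((hQQ ε hε e e').mono fun τ hτ => ?_)
      have ht' : Tendsto (fun σ => |inner ℝ (Q e τ) (Q e' σ) - c e e'|) (𝓝[≠] 0)
          (𝓝 |inner ℝ (Q e τ) (a e') - c e e'|) :=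
        ((tendsto_const_nhds.inner (ha e')).sub_const _).abs
      exact le_of_tendsto ht' hτ
    have hlim : Tendsto (fun ε : ℝ => ε * ‖e‖ * ‖e'‖) (𝓝[>] 0) (𝓝 0) := by
      have : Continuous (fun ε : ℝ => ε * ‖e‖ * ‖e'‖) := by fun_prop
      have h := this.tendsto 0
      simp only [zero_mul] at h
      exact h.mono_left nhdsWithin_le_nhds
    have := ge_of_tendsto hlim (by filter_upwards [self_mem_nhdsWithin] with ε hε using key ε hε)
    exact sub_eq_zero.1 (abs_nonpos_iff.1 this)
  -- By `haa` the inner products of the vectors `a e` are bilinear, so every linearity defect has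
  -- norm zero.
  let A : E →ₗ[ℝ] H :=
    { toFun := a
      map_add' := fun e e' => by
        rw [← sub_eq_zero, ← inner_self_eq_zero (𝕜 := ℝ)]
        simp only [inner_sub_left, inner_sub_right, inner_add_left, inner_add_right, haa, cadd₁,
          cadd₂]
        ring
      map_smul' := fun τ e => by
        rw [← sub_eq_zero, ← inner_self_eq_zero (𝕜 := ℝ)]
        simp only [inner_sub_left, inner_sub_right, real_inner_smul_left, real_inner_smul_right,
          haa, csmul₁, csmul₂, RingHom.id_apply]
        ring }
  have hA : HasFDerivAt Φ (LinearMap.toContinuousLinearMap A) x := by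
    refine .of_isLittleO (Asymptotics.IsLittleO.of_bound fun ε hε => ?_)
    -- In the expanded square of the remainder, the first term contributes one third of `ε ^ 2` and
    -- the doubled cross term two thirds.
    obtain ⟨ρ₁, hρ₁, h₁⟩ := hmixed (ε ^ 2 / 3) (by positivity)
    obtain ⟨ρ₂, hρ₂, h₂⟩ := haz (ε ^ 2 / 3) (by positivity)
    filter_upwards [Metric.ball_mem_nhds x hρ₁, Metric.ball_mem_nhds x hρ₂] with z hz₁ hz₂
    have i1 := abs_le.1 (h₁ z hz₁ z hz₁)
    have i2 := abs_le.1 (h₂ (z - x) z hz₂)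
    have i3 := haa (z - x) (z - x)
    have i4 := norm_sub_sq_real (Φ z - Φ x) (a (z - x))
    rw [← real_inner_self_eq_norm_sq (Φ z - Φ x), ← real_inner_self_eq_norm_sq (a (z - x)), i3,
      real_inner_comm (a (z - x)) (Φ z - Φ x)] at i4
    refine le_of_sq_le_sq ?_ (by positivity)
    simp only [LinearMap.coe_toContinuousLinearMap']
    change ‖Φ z - Φ x - a (z - x)‖ ^ 2 ≤ _
    rw [mul_pow]
    nlinarith [i1.1, i1.2, i2.1, i2.2]
  exact hA.differentiableAt

/-- A feature map of a `C²` kernel is `C¹`. -/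
theorem contDiffOn_one_of_inner_eq {Φ : E → H} {k : E × E → ℝ} {U : Set E} (hU : IsOpen U)
    (hΦ : ∀ y ∈ U, ∀ z ∈ U, inner ℝ (Φ y) (Φ z) = k (y, z))
    (hk : ContDiffOn ℝ 2 k (U ×ˢ U)) : ContDiffOn ℝ 1 Φ U := by
  have hUU : IsOpen (U ×ˢ U) := hU.prod hU
  have hd : DifferentiableOn ℝ Φ U := fun x hx =>
    (differentiableAt_of_inner_eq (hU.mem_nhds hx) hΦ
      (hk.contDiffAt (hUU.mem_nhds ⟨hx, hx⟩))).differentiableWithinAt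
  rw [show (1 : WithTop ℕ∞) = 0 + 1 by norm_num, contDiffOn_succ_iff_fderiv_of_isOpen hU,
    contDiffOn_zero, continuousOn_clm_apply]
  refine ⟨hd, by simp, ?_⟩
  intro e x hx
  set κ : E × E → ℝ := fun p => fderiv ℝ (fun p => fderiv ℝ k p (e, 0)) p (0, e) with hκ
  have hκc : ContinuousOn κ (U ×ˢ U) :=
    (contDiffOn_mixed_fderiv (m := 0) (n := 2) hUU (by norm_num) hk e e).continuousOn
  have hin : ∀ y ∈ U, ∀ z ∈ U, inner ℝ (fderiv ℝ Φ y e) (fderiv ℝ Φ z e) = κ (y, z) :=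
    fun y hy z hz => inner_fderiv_fderiv_eq hU hΦ hd hy hz e e hk
  rw [ContinuousWithinAt, tendsto_iff_norm_sub_tendsto_zero]
  -- This expression is the square of `‖fderiv ℝ Φ y e - fderiv ℝ Φ x e‖`, so continuity of `κ`
  -- gives continuity of the derivative in direction `e`.
  have hsq : Tendsto (fun y => κ (y, y) - 2 * κ (y, x) + κ (x, x)) (𝓝[U] x) (𝓝 0) := by
    have h1 : ContinuousOn (fun y => κ (y, y) - 2 * κ (y, x) + κ (x, x)) U := by
      refine ((hκc.comp (f := fun y => (y, y)) (by fun_prop) fun y hy => ⟨hy, hy⟩).sub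
        (continuousOn_const.mul (hκc.comp (f := fun y => (y, x)) (by fun_prop)
          fun y hy => ⟨hy, hx⟩))).add continuousOn_const
    have h2 := h1 x hx
    rw [ContinuousWithinAt] at h2
    convert h2 using 2
    ring
  have := hsq.sqrt
  rw [Real.sqrt_zero] at this
  refine this.congr' ?_
  filter_upwards [self_mem_nhdsWithin] with y hy
  rw [← hin y hy y hy, ← hin y hy x hx, ← hin x hx x hx, real_inner_self_eq_norm_sq,
    real_inner_self_eq_norm_sq, ← norm_sub_sq_real, Real.sqrt_sq (norm_nonneg _)]

/-- A feature map of a `C⁴` kernel is `C²`. -/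
theorem contDiffOn_two_of_inner_eq {Φ : E → H} {k : E × E → ℝ} {U : Set E} (hU : IsOpen U)
    (hΦ : ∀ y ∈ U, ∀ z ∈ U, inner ℝ (Φ y) (Φ z) = k (y, z))
    (hk : ContDiffOn ℝ 4 k (U ×ˢ U)) : ContDiffOn ℝ 2 Φ U := by
  have hk2 : ContDiffOn ℝ 2 k (U ×ˢ U) := hk.of_le (by norm_num)
  have hd : DifferentiableOn ℝ Φ U :=
    (contDiffOn_one_of_inner_eq hU hΦ hk2).differentiableOn (by norm_num)
  rw [show (2 : WithTop ℕ∞) = 1 + 1 by norm_num, contDiffOn_succ_iff_fderiv_of_isOpen hU]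
  refine ⟨hd, by simp, contDiffOn_clm_apply.2 fun e => ?_⟩
  -- The directional derivative is a feature map of a C² kernel, so the C¹ result applies to it.
  exact contDiffOn_one_of_inner_eq hU
    (fun y hy z hz => inner_fderiv_fderiv_eq hU hΦ hd hy hz e e hk2)
    (contDiffOn_mixed_fderiv (m := 2) (n := 4) (hU.prod hU) (by norm_num) hk e e)

end FeatureMap

/-! ### Representers of the value function and of its Hermite interpolants -/

section Representer

variable {N : ℕ} {Ω : Set (Vec N)} {k : Vec N → Vec N → ℝ}

theorem MemRKHS.exists_featureMap {φ : Vec N → ℝ} (hφ : MemRKHS Ω k φ)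
    (hk : ContDiffOn ℝ 4 (fun p : Vec N × Vec N => k p.1 p.2)
      (convexHull ℝ Ω ×ˢ convexHull ℝ Ω)) :
    ∃ (H : Type) (_ : NormedAddCommGroup H) (_ : InnerProductSpace ℝ H) (_ : CompleteSpace H)
      (Φ : Vec N → H) (h : H), ContDiffOn ℝ 2 Φ (interior Ω) ∧
        (∀ x ∈ Ω, ∀ y ∈ Ω, inner ℝ (Φ x) (Φ y) = k x y) ∧ ∀ x ∈ Ω, φ x = inner ℝ (Φ x) h := by
  classical
  obtain ⟨H, i1, i2, i3, i4, hker, h, hh⟩ := hφ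
  let Φ : Vec N → H := fun x => if hx : x ∈ Ω then RKHS.kerFun H (⟨x, hx⟩ : Ω) 1 else 0
  have hin : ∀ x ∈ Ω, ∀ y ∈ Ω, inner ℝ (Φ x) (Φ y) = k x y := by
    intro x hx y hy
    rw [real_inner_comm]
    simp only [Φ, hx, hy, dif_pos]
    rw [← RKHS.kernel_inner, hker]
    simp
  refine ⟨H, i1, i2, i3, Φ, h, ?_, hin, ?_⟩
  · refine contDiffOn_two_of_inner_eq (k := fun p => k p.1 p.2) isOpen_interior
      (fun x hx y hy => hin x (interior_subset hx) y (interior_subset hy)) (hk.mono ?_)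
    exact prod_mono (interior_subset.trans (subset_convexHull ℝ Ω))
      (interior_subset.trans (subset_convexHull ℝ Ω))
  · intro x hx
    simp only [Φ, hx, dif_pos, RKHS.kerFun_inner]
    rw [hh ⟨x, hx⟩]
    simp

variable {H : Type*} [NormedAddCommGroup H] [InnerProductSpace ℝ H] [CompleteSpace H]
  {Φ : Vec N → H}

theorem hasGradientAt_inner {x : Vec N} (hΦ : DifferentiableAt ℝ Φ x) (h : H) :
    HasGradientAt (fun y => inner ℝ (Φ y) h) ((fderiv ℝ Φ x).adjoint h) x := by
  rw [hasGradientAt_iff_hasFDerivAt]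
  have := (innerSL ℝ h).hasFDerivAt.comp x hΦ.hasFDerivAt
  refine (this.congr_fderiv ?_).congr_of_eventuallyEq ?_
  · ext e
    simp [ContinuousLinearMap.adjoint_inner_left]
  · filter_upwards with y
    simp [real_inner_comm]

/-- The representation holds only on Ω, so interior points are needed to determine the germ of `φ`.
The gradient is linear in `h`, which later makes the closed-loop field affine in the representer. -/
theorem gradient_eq_adjoint_fderiv {φ : Vec N → ℝ} {h : H}
    (hφ : ∀ x ∈ Ω, φ x = inner ℝ (Φ x) h) {x : Vec N} (hx : x ∈ interior Ω)
    (hΦ : DifferentiableAt ℝ Φ x) : HasGradientAt φ ((fderiv ℝ Φ x).adjoint h) x := by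
  refine (hasGradientAt_inner hΦ h).congr_of_eventuallyEq ?_
  filter_upwards [mem_interior_iff_mem_nhds.1 hx] with y hy using hφ y hy

theorem hermiteSum_eq_inner (hin : ∀ x ∈ Ω, ∀ y ∈ Ω, inner ℝ (Φ x) (Φ y) = k x y)
    (hΦ : DifferentiableOn ℝ Φ (interior Ω)) {X : Finset (Vec N)} (hX : ↑X ⊆ interior Ω)
    (α : Vec N → ℝ) (β : Vec N → Vec N) {x : Vec N} (hx : x ∈ Ω) :
    hermiteSum k X α β x = inner ℝ (Φ x) (∑ y ∈ X, (α y • Φ y + fderiv ℝ Φ y (β y))) := by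
  rw [hermiteSum, inner_sum]
  refine Finset.sum_congr rfl fun y hy => ?_
  have hyU := hX hy
  have hg := gradient_eq_adjoint_fderiv (Ω := Ω) (φ := fun z => k z x) (h := Φ x)
    (fun z hz => (hin z hz x hx).symm) hyU (hΦ.differentiableAt (isOpen_interior.mem_nhds hyU))
  rw [hg.gradient, inner_add_right, real_inner_smul_right, ContinuousLinearMap.adjoint_inner_right,
    hin x hx y (interior_subset hyU), ← hin y (interior_subset hyU) x hx, real_inner_comm,
    hin x hx y (interior_subset hyU), real_inner_comm]

/-- A Hermite interpolant is represented by the orthogonal projection of the interpolated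
function, so its norm is at most that of the function. -/
theorem IsHermiteInterpolant.exists_representer
    (hin : ∀ x ∈ Ω, ∀ y ∈ Ω, inner ℝ (Φ x) (Φ y) = k x y)
    (hΦ : DifferentiableOn ℝ Φ (interior Ω)) {v s : Vec N → ℝ} {h : H}
    (hv : ∀ x ∈ Ω, v x = inner ℝ (Φ x) h) {X : Finset (Vec N)} (hX : ↑X ⊆ interior Ω)
    (hs : IsHermiteInterpolant k v X s) :
    ∃ h' : H, ‖h'‖ ≤ ‖h‖ ∧ ∀ x ∈ Ω, s x = inner ℝ (Φ x) h' := by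
  obtain ⟨⟨α, β, rfl⟩, hint⟩ := hs
  set h' : H := ∑ y ∈ X, (α y • Φ y + fderiv ℝ Φ y (β y)) with hh'
  have hrep : ∀ x ∈ Ω, hermiteSum k X α β x = inner ℝ (Φ x) h' := fun x hx =>
    hermiteSum_eq_inner hin hΦ hX α β hx
  -- `h'` is a combination of the vectors `Φ y` and `fderiv ℝ Φ y (β y)`; interpolation of values
  -- and gradients says precisely that these have the same inner products with `h'` and with `h`.
  have horth : inner ℝ h' h' = inner ℝ h' h := by
    nth_rewrite 1 [hh']
    nth_rewrite 2 [hh']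
    rw [sum_inner, sum_inner]
    refine Finset.sum_congr rfl fun y hy => ?_
    have hyU := hX hy
    have hd := hΦ.differentiableAt (isOpen_interior.mem_nhds hyU)
    have h1 := (hint y hy).1
    have h2 := (hint y hy).2
    rw [hrep y (interior_subset hyU), hv y (interior_subset hyU)] at h1
    rw [(gradient_eq_adjoint_fderiv hrep hyU hd).gradient,
      (gradient_eq_adjoint_fderiv hv hyU hd).gradient] at h2
    rw [inner_add_left, inner_add_left, real_inner_smul_left, real_inner_smul_left, h1,
      ← ContinuousLinearMap.adjoint_inner_right, ← ContinuousLinearMap.adjoint_inner_right, h2]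
  refine ⟨h', ?_, hrep⟩
  by_contra! hlt
  have h1 := real_inner_le_norm h' h
  rw [← horth, real_inner_self_eq_norm_sq] at h1
  nlinarith [norm_nonneg h]

theorem VKOGAReachable.subset {v : Vec N → ℝ} {D : Set (Vec N)} {tol : ℝ} {X : Finset (Vec N)}
    {s : Vec N → ℝ} (h : VKOGAReachable k v D tol X s) : ↑X ⊆ D := by
  induction h with
  | init => simp
  | step prev mem notMem continues argmax interp ih =>
    simp only [Finset.coe_cons]
    exact insert_subset mem ih

theorem VKOGAReachable.isHermiteInterpolant {v : Vec N → ℝ} {D : Set (Vec N)} {tol : ℝ}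
    {X : Finset (Vec N)} {s : Vec N → ℝ} (h : VKOGAReachable k v D tol X s) :
    IsHermiteInterpolant k v X s := by
  cases h with
  | init => exact ⟨⟨0, 0, by ext; simp [hermiteSum]⟩, by simp⟩
  | step prev mem notMem continues argmax interp => exact interp

/-- The stopping test ignores the centers, but there the interpolation conditions make the error
zero. -/
theorem IsVKOGAOutput.hermiteError_le {v : Vec N → ℝ} {D : Set (Vec N)} {tol : ℝ}
    (htol : 0 ≤ tol) {s : Vec N → ℝ} (h : IsVKOGAOutput k v D tol s) {x : Vec N} (hx : x ∈ D) :
    hermiteError v s x ≤ tol := by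
  obtain ⟨X, hX, hle⟩ := h
  by_cases hxX : x ∈ X
  · obtain ⟨h1, h2⟩ := hX.isHermiteInterpolant.2 x hxX
    simpa [hermiteError, h1, h2] using htol
  · exact hle x hx hxX

end Representer

/-! ### Dynamic programming -/

namespace ControlProblem

variable {N M : ℕ} (P : ControlProblem N M)

/-- The velocity `f(x) + g(x) u`. -/
def velocity (x : Vec N) (u : Vec M) : Vec N := P.f x + (P.g x).toEuclideanLin u

/-- The running cost `r(x) + uᵀ R u`. -/
def runningCost (x : Vec N) (u : Vec M) : ℝ := P.r x + inner ℝ u (P.R.toEuclideanLin u)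

theorem inner_weight_nonneg (u : Vec M) : 0 ≤ inner ℝ u (P.R.toEuclideanLin u) := by
  have := P.R_posDef.posSemidef.dotProduct_mulVec_nonneg u.ofLp
  simpa [PiLp.inner_apply, dotProduct, Matrix.toLpLin_apply, mul_comm] using this

theorem runningCost_nonneg (x : Vec N) (u : Vec M) : 0 ≤ P.runningCost x u :=
  add_nonneg (P.r_nonneg x) (P.inner_weight_nonneg u)

theorem continuous_runningCost : Continuous fun p : Vec N × Vec M => P.runningCost p.1 p.2 := by
  have h1 := P.r_continuous
  have h2 : Continuous P.R.toEuclideanLin := LinearMap.continuous_of_finiteDimensional _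
  unfold runningCost
  fun_prop

theorem cost_eq (x : ℝ → Vec N) (u : ℝ → Vec M) :
    P.cost x u = ∫⁻ s in Ici (0 : ℝ), ENNReal.ofReal (P.runningCost (x s) (u s)) := rfl

theorem value_le_cost {x₀ : Vec N} {x : ℝ → Vec N} {u : ℝ → Vec M} (h : P.IsAdmissible x₀ x u) :
    P.value x₀ ≤ P.cost x u :=
  iInf_le_of_le x (iInf_le_of_le u (iInf_le_of_le h le_rfl))

theorem setLIntegral_Ici_sub (F : ℝ → ℝ≥0∞) (t : ℝ) :
    ∫⁻ s in Ici t, F (s - t) = ∫⁻ s in Ici (0 : ℝ), F s := by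
  have := (measurePreserving_sub_right volume t).setLIntegral_comp_preimage_emb
    (MeasurableEquiv.subRight t).measurableEmbedding F (Ici 0)
  simpa using this

theorem setLIntegral_Ici_split (F : ℝ → ℝ≥0∞) {t : ℝ} (ht : 0 ≤ t) :
    ∫⁻ s in Ici (0 : ℝ), F s = (∫⁻ s in Ico 0 t, F s) + ∫⁻ s in Ici t, F s := by
  rw [← Ico_union_Ici_eq_Ici ht, lintegral_union measurableSet_Ici]
  exact disjoint_left.2 fun s hs hs' => not_lt.2 hs' hs.2

variable {P}

theorem IsAdmissible.initial {x₀ : Vec N} {x : ℝ → Vec N} {u : ℝ → Vec M}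
    (h : P.IsAdmissible x₀ x u) : x 0 = x₀ := by
  simpa using h.eq_integral 0 le_rfl

theorem IsAdmissible.continuousOn {x₀ : Vec N} {x : ℝ → Vec N} {u : ℝ → Vec M}
    (h : P.IsAdmissible x₀ x u) : ContinuousOn x (Ici 0) := by
  intro t ht
  have ht : 0 ≤ t := ht
  have h1 : (0 : ℝ) ≤ t + 1 := by linarith
  have hc := intervalIntegral.continuousOn_primitive_interval' (h.integrable (t + 1) h1)
    (left_mem_uIcc)
  rw [uIcc_of_le h1] at hc
  have hx : ContinuousOn x (Icc 0 (t + 1)) :=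
    (continuousOn_const.add hc).congr fun s hs => h.eq_integral s hs.1
  refine (hx t ⟨ht, by linarith⟩).mono_of_mem_nhdsWithin ?_
  rw [← Ici_inter_Iic]
  exact inter_mem self_mem_nhdsWithin (mem_nhdsWithin_of_mem_nhds (Iic_mem_nhds (by linarith)))

/-- The tail of an admissible process is admissible. -/
theorem IsAdmissible.tail {x₀ : Vec N} {x : ℝ → Vec N} {u : ℝ → Vec M}
    (h : P.IsAdmissible x₀ x u) {t : ℝ} (ht : 0 ≤ t) :
    P.IsAdmissible (x t) (fun s => x (s + t)) (fun s => u (s + t)) where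
  measurable_control := h.measurable_control.comp (measurable_add_const t)
  integrable s hs := by
    have h1 : IntervalIntegrable (fun s => P.f (x s) + (P.g (x s)).toEuclideanLin (u s))
        volume t (s + t) :=
      (h.integrable t ht).symm.trans (h.integrable (s + t) (by linarith))
    simpa using h1.comp_add_right t
  eq_integral s hs := by
    have h0 := h.eq_integral (s + t) (by linarith)
    rw [← intervalIntegral.integral_add_adjacent_intervals (h.integrable t ht)
      ((h.integrable t ht).symm.trans (h.integrable (s + t) (by linarith))), ← add_assoc,
      ← h.eq_integral t ht] at h0
    rw [h0, intervalIntegral.integral_comp_add_right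
      (fun s => P.f (x s) + (P.g (x s)).toEuclideanLin (u s))]
    simp

theorem IsAdmissible.cost_eq_add_tail {x₀ : Vec N} {x : ℝ → Vec N} {u : ℝ → Vec M}
    (_ : P.IsAdmissible x₀ x u) {t : ℝ} (ht : 0 ≤ t) :
    P.cost x u = (∫⁻ s in Ico 0 t, ENNReal.ofReal (P.runningCost (x s) (u s))) +
      P.cost (fun s => x (s + t)) (fun s => u (s + t)) := by
  rw [cost_eq, cost_eq, setLIntegral_Ici_split _ ht, ← setLIntegral_Ici_sub _ t]
  simp

/-- Following a control up to time `t` and then an arbitrary admissible process costs at least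
the value of the initial state. -/
theorem value_le_setLIntegral_add_value {x₀ : Vec N} {x : ℝ → Vec N} {u : ℝ → Vec M} {t : ℝ}
    (ht : 0 ≤ t) (hu : Measurable u)
    (hint : IntervalIntegrable (fun s => P.velocity (x s) (u s)) volume 0 t)
    (heq : ∀ s ∈ Icc 0 t, x s = x₀ + ∫ τ in (0 : ℝ)..s, P.velocity (x τ) (u τ)) :
    P.value x₀ ≤ (∫⁻ s in Ico 0 t, ENNReal.ofReal (P.runningCost (x s) (u s))) +
      P.value (x t) := by
  conv_rhs => rw [value]
  simp only [ENNReal.add_iInf]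
  refine le_iInf fun x' => le_iInf fun u' => le_iInf fun h' => ?_
  -- Concatenation at time `t` of the given process with a competitor starting at `x t`.
  set X : ℝ → Vec N := fun s => if s < t then x s else x' (s - t) with hX
  set W : ℝ → Vec M := fun s => if s < t then u s else u' (s - t) with hW
  have hlt : ∀ s, s < t → X s = x s ∧ W s = u s := fun s hs => by simp [hX, hW, hs]
  have hge : ∀ s, t ≤ s → X s = x' (s - t) ∧ W s = u' (s - t) := fun s hs => by
    simp [hX, hW, not_lt.2 hs]
  have hv1 : ∀ s, s ≤ t → EqOn (fun τ => P.velocity (x τ) (u τ))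
      (fun τ => P.velocity (X τ) (W τ)) (Ioo 0 s) := fun s hs τ hτ => by
    simp only [hlt τ (hτ.2.trans_le hs)]
  have hv2 : ∀ s, t ≤ s → EqOn (fun τ => P.velocity (x' (τ - t)) (u' (τ - t)))
      (fun τ => P.velocity (X τ) (W τ)) (Ioo t s) := fun s _ τ hτ => by
    simp only [hge τ hτ.1.le]
  have hi1 : ∀ s, 0 ≤ s → s ≤ t →
      IntervalIntegrable (fun τ => P.velocity (X τ) (W τ)) volume 0 s := by
    intro s hs hst
    refine (hint.mono_set ?_).congr_uIoo ?_
    · rw [uIcc_of_le hs, uIcc_of_le ht]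
      exact Icc_subset_Icc_right hst
    · rw [uIoo_of_le hs]
      exact hv1 s hst
  have hi2 : ∀ s, t ≤ s → IntervalIntegrable (fun τ => P.velocity (X τ) (W τ)) volume t s := by
    intro s hst
    have := (h'.integrable (s - t) (by linarith)).comp_sub_right t
    simp only [zero_add, sub_add_cancel] at this
    refine this.congr_uIoo ?_
    rw [uIoo_of_le hst]
    exact hv2 s hst
  have hadm : P.IsAdmissible x₀ X W := by
    refine ⟨Measurable.ite measurableSet_Iio hu
      (h'.measurable_control.comp (measurable_sub_const t)), fun s hs => ?_, fun s hs => ?_⟩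
    · rcases le_total s t with hst | hst
      · exact hi1 s hs hst
      · exact (hi1 t ht le_rfl).trans (hi2 s hst)
    · change X s = x₀ + ∫ τ in (0 : ℝ)..s, P.velocity (X τ) (W τ)
      rcases lt_or_ge s t with hst | hst
      · rw [(hlt s hst).1, heq s ⟨hs, hst.le⟩,
          intervalIntegral.integral_congr_uIoo (by rw [uIoo_of_le hs]; exact hv1 s hst.le)]
      · have e1 : ∫ τ in (0 : ℝ)..t, P.velocity (X τ) (W τ)
            = ∫ τ in (0 : ℝ)..t, P.velocity (x τ) (u τ) :=
          (intervalIntegral.integral_congr_uIoo (by rw [uIoo_of_le ht]; exact hv1 t le_rfl)).symm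
        have e2 : ∫ τ in t..s, P.velocity (X τ) (W τ)
            = ∫ τ in (0 : ℝ)..(s - t), P.velocity (x' τ) (u' τ) := by
          rw [← intervalIntegral.integral_congr_uIoo (by rw [uIoo_of_le hst]; exact hv2 s hst),
            intervalIntegral.integral_comp_sub_right (fun τ => P.velocity (x' τ) (u' τ)), sub_self]
        rw [← intervalIntegral.integral_add_adjacent_intervals (hi1 t ht le_rfl) (hi2 s hst),
          e1, e2, ← add_assoc, ← heq t ⟨ht, le_rfl⟩, (hge s hst).1,
          h'.eq_integral (s - t) (by linarith)]
        rfl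
  refine (P.value_le_cost hadm).trans_eq ?_
  rw [cost_eq, setLIntegral_Ici_split _ ht, cost_eq, ← setLIntegral_Ici_sub _ t]
  congr 1
  · refine setLIntegral_congr_fun measurableSet_Ico fun s hs => ?_
    simp only [hlt s hs.2]
  · refine setLIntegral_congr_fun measurableSet_Ici fun s hs => ?_
    simp only [hge s hs]

/-- Bellman's principle along an optimal process. -/
theorem IsOptimal.value_eq {x₀ : Vec N} {x : ℝ → Vec N} {u : ℝ → Vec M}
    (h : P.IsOptimal x₀ x u) {t : ℝ} (ht : 0 ≤ t) :
    P.value x₀ = (∫⁻ s in Ico 0 t, ENNReal.ofReal (P.runningCost (x s) (u s))) +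
      P.value (x t) := by
  refine le_antisymm (value_le_setLIntegral_add_value ht h.1.measurable_control
    (h.1.integrable t ht) fun s hs => h.1.eq_integral s hs.1) ?_
  rw [← h.2, h.1.cost_eq_add_tail ht]
  gcongr
  exact P.value_le_cost (h.1.tail ht)

theorem IsOptimal.value_le {x₀ : Vec N} {x : ℝ → Vec N} {u : ℝ → Vec M}
    (h : P.IsOptimal x₀ x u) {t : ℝ} (ht : 0 ≤ t) : P.value (x t) ≤ P.value x₀ := by
  rw [h.value_eq ht]
  exact le_add_self

theorem IsOptimal.intervalIntegrable_runningCost {x₀ : Vec N} {x : ℝ → Vec N} {u : ℝ → Vec M}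
    (h : P.IsOptimal x₀ x u) (hfin : P.value x₀ ≠ ⊤) {t : ℝ} (ht : 0 ≤ t) :
    IntervalIntegrable (fun s => P.runningCost (x s) (u s)) volume 0 t := by
  rw [intervalIntegrable_iff_integrableOn_Ico_of_le ht, IntegrableOn]
  have hm : AEStronglyMeasurable (fun s => P.runningCost (x s) (u s))
      (volume.restrict (Ico 0 t)) := by
    have hx : AEMeasurable x (volume.restrict (Ico 0 t)) :=
      (h.1.continuousOn.mono Ico_subset_Ici_self).aemeasurable measurableSet_Ico
    exact (P.continuous_runningCost.measurable.comp_aemeasurable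
      (hx.prodMk h.1.measurable_control.aemeasurable)).aestronglyMeasurable
  rw [← lintegral_ofReal_ne_top_iff_integrable hm
    (Eventually.of_forall fun s => P.runningCost_nonneg _ _)]
  intro htop
  rw [h.value_eq ht, htop] at hfin
  simp at hfin

/-- Bellman's principle with real values: finiteness of the value permits subtraction. Almost
everywhere, differentiation in `t` gives minus the running cost. -/
theorem IsOptimal.v_eq {x₀ : Vec N} {x : ℝ → Vec N} {u : ℝ → Vec M}
    (h : P.IsOptimal x₀ x u) (hfin : P.value x₀ ≠ ⊤) {t : ℝ} (ht : 0 ≤ t) :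
    P.v (x t) = P.v x₀ - ∫ s in (0 : ℝ)..t, P.runningCost (x s) (u s) := by
  have hi := h.intervalIntegrable_runningCost hfin ht
  rw [intervalIntegrable_iff_integrableOn_Ico_of_le ht] at hi
  have h0 := h.value_eq ht
  rw [← ofReal_integral_eq_lintegral_ofReal hi
    (Eventually.of_forall fun s => P.runningCost_nonneg _ _), integral_Ico_eq_integral_Ioc,
    ← intervalIntegral.integral_of_le ht] at h0
  have hfin' : P.value (x t) ≠ ⊤ := ((h.value_le ht).trans_lt hfin.lt_top).ne
  rw [v, v, h0, ENNReal.toReal_add ENNReal.ofReal_ne_top hfin', ENNReal.toReal_ofReal]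
  · ring
  · exact intervalIntegral.integral_nonneg ht fun s _ => P.runningCost_nonneg _ _

end ControlProblem

theorem toEuclideanLin_inner {m n : ℕ} (A : Matrix (Fin m) (Fin n) ℝ) (x : Vec n) (y : Vec m) :
    inner ℝ (A.toEuclideanLin x) y = inner ℝ x (A.transpose.toEuclideanLin y) := by
  rw [← Matrix.conjTranspose_eq_transpose_of_trivial,
    Matrix.toEuclideanLin_conjTranspose_eq_adjoint, LinearMap.adjoint_inner_right]

theorem toEuclideanLin_mul_apply {l m n : ℕ} (A : Matrix (Fin l) (Fin m) ℝ)
    (B : Matrix (Fin m) (Fin n) ℝ) (x : Vec n) :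
    (A * B).toEuclideanLin x = A.toEuclideanLin (B.toEuclideanLin x) := by
  simp [Matrix.toLpLin_apply]

/-! ### Hamilton-Jacobi-Bellman equation and optimal feedback -/

namespace ControlProblem

variable {N M : ℕ} (P : ControlProblem N M)

/-- The optimal feedback for the costate `p` at the state `x`. -/
def feedback (x p : Vec N) : Vec M :=
  -(1 / 2 : ℝ) • (P.R⁻¹ * (P.g x).transpose).toEuclideanLin p

/-- The Hamiltonian is quadratic in the control, so its minimizer satisfies `gᵀ p + 2 R u = 0`, and
`R` is invertible. -/
theorem eq_feedback_of_isMinimizer {x p : Vec N} {u : Vec M}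
    (hmin : ∀ ω, 0 ≤ inner ℝ p (P.velocity x ω) + P.runningCost x ω)
    (hu : inner ℝ p (P.velocity x u) + P.runningCost x u = 0) : u = P.feedback x p := by
  have hsymm : P.R.transpose = P.R := by
    have := P.R_posDef.isHermitian
    rwa [Matrix.IsHermitian, Matrix.conjTranspose_eq_transpose_of_trivial] at this
  have hcrit : ∀ d, inner ℝ ((P.g x).transpose.toEuclideanLin p
      + (2 : ℝ) • P.R.toEuclideanLin u) d = 0 := by
    intro d
    set b := inner ℝ ((P.g x).transpose.toEuclideanLin p + (2 : ℝ) • P.R.toEuclideanLin u) d with hb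
    set q := inner ℝ d (P.R.toEuclideanLin d) with hq
    have hexp : ∀ τ : ℝ, 0 ≤ τ * b + τ ^ 2 * q := by
      intro τ
      have h1 := hmin (u + τ • d)
      have e1 : inner ℝ p ((P.g x).toEuclideanLin d)
          = inner ℝ ((P.g x).transpose.toEuclideanLin p) d := by
        rw [real_inner_comm, toEuclideanLin_inner, real_inner_comm]
      have e2 : inner ℝ u (P.R.toEuclideanLin d) = inner ℝ (P.R.toEuclideanLin u) d := by
        rw [toEuclideanLin_inner, hsymm]
      have e3 : inner ℝ d (P.R.toEuclideanLin u) = inner ℝ (P.R.toEuclideanLin u) d :=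
        real_inner_comm _ _
      have : inner ℝ p (P.velocity x (u + τ • d)) + P.runningCost x (u + τ • d)
          = (inner ℝ p (P.velocity x u) + P.runningCost x u) + (τ * b + τ ^ 2 * q) := by
        simp only [velocity, runningCost, map_add, map_smul, inner_add_left, inner_add_right,
          real_inner_smul_left, real_inner_smul_right, hb, hq, e1, e2, e3]
        ring
      rw [this, hu, zero_add] at h1
      exact h1
    have hq0 : 0 ≤ q := P.inner_weight_nonneg d
    -- Dividing by `q + 1` instead of `q` avoids the case `q = 0` and still leaves `-(b / (q + 1)) ^
    -- 2`.
    have h1 := hexp (-b / (q + 1))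
    have h2 : -b / (q + 1) * b + (-b / (q + 1)) ^ 2 * q = -(b ^ 2 / (q + 1) ^ 2) := by
      field_simp
      ring
    rw [h2] at h1
    have h3 : 0 ≤ b ^ 2 / (q + 1) ^ 2 := by positivity
    have h4 : b ^ 2 / (q + 1) ^ 2 = 0 := by linarith
    have h5 : (q + 1) ^ 2 ≠ 0 := by positivity
    rcases div_eq_zero_iff.1 h4 with h | h
    · exact pow_eq_zero_iff (two_ne_zero) |>.1 h
    · exact absurd h h5
  have h0 := inner_self_eq_zero.1 (hcrit _)
  have hdet : IsUnit P.R.det := P.R_posDef.det_pos.ne'.isUnit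
  have h1 : (P.R⁻¹ * (P.g x).transpose).toEuclideanLin p + (2 : ℝ) • u = 0 := by
    have := congrArg P.R⁻¹.toEuclideanLin h0
    rw [map_add, map_smul, map_zero, ← toEuclideanLin_mul_apply, ← toEuclideanLin_mul_apply,
      Matrix.nonsing_inv_mul _ hdet] at this
    simpa using this
  rw [feedback, eq_neg_of_add_eq_zero_left h1]
  simp [smul_smul]

variable {P}

/-- The Hamilton-Jacobi-Bellman inequality at a point where the value function is
differentiable. -/
theorem hamiltonian_nonneg {y p : Vec N} (hf : ContDiffAt ℝ 1 P.f y)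
    (hg : ∀ i j, ContDiffAt ℝ 1 (fun x => P.g x i j) y)
    (hfin : ∀ᶠ x in 𝓝 y, P.value x ≠ ⊤) (hv : HasGradientAt P.v p y) (ω : Vec M) :
    0 ≤ inner ℝ p (P.velocity y ω) + P.runningCost y ω := by
  have hF : ContDiffAt ℝ 1 (fun x => P.velocity x ω) y := by
    refine hf.add ?_
    rw [contDiffAt_piLp]
    intro i
    simp only [Matrix.toLpLin_apply, Matrix.mulVec, dotProduct]
    exact ContDiffAt.sum fun j _ => (hg i j).mul contDiffAt_const
  -- Test trajectory through `y` under the constant control `ω`.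
  obtain ⟨z, hz0, ε, hε, hz⟩ :=
    hF.exists_forall_mem_closedBall_exists_eq_forall_mem_Ioo_hasDerivAt₀ 0
  simp only [zero_sub, zero_add] at hz
  have hzd : HasDerivAt z (P.velocity y ω) 0 := by
    have := hz 0 ⟨by linarith, hε⟩
    rwa [hz0] at this
  have hz_tendsto : Tendsto z (𝓝 0) (𝓝 y) := by
    have := hzd.continuousAt.tendsto
    rwa [hz0] at this
  have hvz : HasDerivAt (fun t => P.v (z t)) (inner ℝ p (P.velocity y ω)) 0 := by
    have h1 : HasFDerivAt P.v (InnerProductSpace.toDual ℝ (Vec N) p) (z 0) := by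
      rw [hz0]; exact hv.hasFDerivAt
    have h2 := h1.comp_hasDerivAt 0 hzd
    rwa [InnerProductSpace.toDual_apply_apply] at h2
  -- The slack in `κ` bounds the running cost near `y` by continuity, so following `ω` up to time
  -- `t` costs at most `κ * t`. Dividing by `t` and letting `t` decrease to 0 gives the claim.
  have hkey : ∀ κ, P.runningCost y ω < κ → 0 ≤ inner ℝ p (P.velocity y ω) + κ := by
    intro κ hκ
    have hev : ∀ᶠ t in 𝓝 (0 : ℝ), P.runningCost (z t) ω < κ ∧ P.value (z t) ≠ ⊤ ∧
        ContinuousAt (fun x => P.velocity x ω) (z t) := by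
      have h1 : ContinuousAt (fun x => P.runningCost x ω) y :=
        (P.continuous_runningCost.comp (Continuous.prodMk_left ω)).continuousAt
      have h2 : ∀ᶠ x in 𝓝 y, ContinuousAt (fun x => P.velocity x ω) x :=
        (hF.eventually (by simp)).mono fun x hx => hx.continuousAt
      exact hz_tendsto.eventually ((h1.eventually_lt_const hκ).and (hfin.and h2))
    obtain ⟨ε', hε', hball⟩ := Metric.eventually_nhds_iff_ball.1 hev
    set ε₀ := min ε ε' with hε₀
    have hε₀pos : 0 < ε₀ := lt_min hε hε'
    have hineq : ∀ t ∈ Ioo 0 ε₀, P.v y ≤ κ * t + P.v (z t) := by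
      intro t ht
      have hmem : ∀ s ∈ Icc 0 t, s ∈ Metric.ball (0 : ℝ) ε' ∧ s ∈ Ioo (-ε) ε := by
        intro s hs
        have h1 : s < ε₀ := hs.2.trans_lt ht.2
        refine ⟨?_, by linarith [hs.1], h1.trans_le (min_le_left _ _)⟩
        rw [Metric.mem_ball, Real.dist_eq, sub_zero, abs_of_nonneg hs.1]
        exact h1.trans_le (min_le_right _ _)
      have hcont : ContinuousOn (fun s => P.velocity (z s) ω) (Icc 0 t) := fun s hs =>
        (ContinuousAt.comp (g := fun x => P.velocity x ω) (hball s (hmem s hs).1).2.2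
          (hz s (hmem s hs).2).continuousAt).continuousWithinAt
      have hint : ∀ s ∈ Icc 0 t,
          IntervalIntegrable (fun s => P.velocity (z s) ω) volume 0 s := by
        intro s hs
        refine ContinuousOn.intervalIntegrable ?_
        rw [uIcc_of_le hs.1]
        exact hcont.mono (Icc_subset_Icc_right hs.2)
      have h1 := value_le_setLIntegral_add_value (P := P) (x₀ := y) (x := z) (u := fun _ => ω)
        ht.1.le measurable_const (hint t ⟨ht.1.le, le_rfl⟩) (fun s hs => by
          rw [intervalIntegral.integral_eq_sub_of_hasDerivAt (f := z) (fun τ hτ => ?_)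
            (hint s hs), hz0]
          · abel
          · rw [uIcc_of_le hs.1] at hτ
            exact hz τ (hmem τ ⟨hτ.1, hτ.2.trans hs.2⟩).2)
      have h2 : ∫⁻ s in Ico 0 t, ENNReal.ofReal (P.runningCost (z s) ω)
          ≤ ENNReal.ofReal (κ * t) := by
        calc _ ≤ ∫⁻ _ in Ico 0 t, ENNReal.ofReal κ := by
              refine setLIntegral_mono' measurableSet_Ico fun s hs => ?_
              exact ENNReal.ofReal_le_ofReal (hball s (hmem s ⟨hs.1, hs.2.le⟩).1).1.le
          _ = ENNReal.ofReal (κ * t) := by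
              rw [setLIntegral_const, Real.volume_Ico, sub_zero,
                ← ENNReal.ofReal_mul ((P.runningCost_nonneg _ _).trans hκ.le)]
      have hκt : 0 ≤ κ * t := mul_nonneg ((P.runningCost_nonneg _ _).trans hκ.le) ht.1.le
      have hzt : P.value (z t) ≠ ⊤ := (hball t (hmem t ⟨ht.1.le, le_rfl⟩).1).2.1
      have h3 := ENNReal.toReal_mono (ENNReal.add_ne_top.2 ⟨ENNReal.ofReal_ne_top, hzt⟩)
        (h1.trans (add_le_add_left h2 _))
      rwa [ENNReal.toReal_add ENNReal.ofReal_ne_top hzt, ENNReal.toReal_ofReal hκt] at h3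
    have hψ : HasDerivAt (fun t => κ * t + P.v (z t)) (κ + inner ℝ p (P.velocity y ω)) 0 := by
      have h1 := ((hasDerivAt_id (0 : ℝ)).const_mul κ).add hvz
      rwa [mul_one] at h1
    have hslope := (hasDerivAt_iff_tendsto_slope.1 hψ).mono_left
      (nhdsWithin_mono 0 (s := Ioi 0) (fun t (ht : 0 < t) => ht.ne'))
    rw [add_comm]
    refine ge_of_tendsto hslope ?_
    filter_upwards [Ioo_mem_nhdsGT hε₀pos] with t ht
    rw [slope_def_field, hz0]
    refine div_nonneg ?_ (by linarith [ht.1])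
    linarith [hineq t ht]
  refine le_of_forall_pos_le_add fun η hη => ?_
  have := hkey (P.runningCost y ω + η) (by linarith)
  linarith

/-- An optimal trajectory solves the closed-loop equation of the value function. -/
theorem IsOptimal.hasDerivWithinAt {x₀ : Vec N} {x : ℝ → Vec N} {u : ℝ → Vec M}
    (h : P.IsOptimal x₀ x u) (hfin₀ : P.value x₀ ≠ ⊤) {U : Set (Vec N)} (hU : IsOpen U)
    (hxU : ∀ t, 0 ≤ t → x t ∈ U) (hf : ContDiffOn ℝ 1 P.f U)
    (hg : ∀ i j, ContDiffOn ℝ 1 (fun x => P.g x i j) U) (hfin : ∀ y ∈ U, P.value y ≠ ⊤)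
    (hv : DifferentiableOn ℝ P.v U) (hcont : ContinuousOn (P.closedLoop P.v) U)
    {t : ℝ} (ht : 0 ≤ t) :
    HasDerivWithinAt x (P.closedLoop P.v (x t)) (Ici 0) t := by
  -- At almost every time both integrals are differentiable (intervals `[0, n]` suffice). Computing
  -- the derivative of `v` along `x` by the chain rule and by Bellman's principle shows that the
  -- Hamiltonian vanishes at `u s`.
  have hae : ∀ᵐ s : ℝ, 0 < s → P.velocity (x s) (u s) = P.closedLoop P.v (x s) := by
    have h1 : ∀ᵐ s : ℝ, ∀ n : ℕ, s ∈ uIcc (0 : ℝ) n → ∀ c ∈ uIcc (0 : ℝ) n,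
        HasDerivAt (fun s => ∫ τ in c..s, P.velocity (x τ) (u τ)) (P.velocity (x s) (u s)) s :=
      ae_all_iff.2 fun n =>
        IntervalIntegrable.ae_hasDerivAt_integral (h.1.integrable n n.cast_nonneg)
    have h2 : ∀ᵐ s : ℝ, ∀ n : ℕ, s ∈ uIcc (0 : ℝ) n → ∀ c ∈ uIcc (0 : ℝ) n,
        HasDerivAt (fun s => ∫ τ in c..s, P.runningCost (x τ) (u τ))
          (P.runningCost (x s) (u s)) s :=
      ae_all_iff.2 fun n =>
        (h.intervalIntegrable_runningCost hfin₀ n.cast_nonneg).ae_hasDerivAt_integral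
    filter_upwards [h1, h2] with s hs1 hs2 hs
    obtain ⟨n, hn⟩ := exists_nat_ge s
    have hmem : s ∈ uIcc (0 : ℝ) n := by rw [uIcc_of_le n.cast_nonneg]; exact ⟨hs.le, hn⟩
    have d1 := (hs1 n hmem 0 left_mem_uIcc).const_add x₀
    have d2 := (hs2 n hmem 0 left_mem_uIcc).const_sub (P.v x₀)
    have d1' : HasDerivAt x (P.velocity (x s) (u s)) s := by
      refine d1.congr_of_eventuallyEq ?_
      filter_upwards [Ioi_mem_nhds hs] with τ hτ
      exact h.1.eq_integral τ (le_of_lt hτ)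
    have d2' : HasDerivAt (fun τ => P.v (x τ)) (-P.runningCost (x s) (u s)) s := by
      refine d2.congr_of_eventuallyEq ?_
      filter_upwards [Ioi_mem_nhds hs] with τ hτ
      exact h.v_eq hfin₀ (le_of_lt hτ)
    have hnhds := hU.mem_nhds (hxU s hs.le)
    have hgrad := (hv.differentiableAt hnhds).hasGradientAt
    have d3 := hgrad.hasFDerivAt.comp_hasDerivAt s d1'
    have heq := d3.unique d2'
    simp only [InnerProductSpace.toDual_apply_apply] at heq
    have hmin := eq_feedback_of_isMinimizer P (x := x s) (p := gradient P.v (x s)) (u := u s)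
      (fun ω => hamiltonian_nonneg (hf.contDiffAt hnhds) (fun i j => (hg i j).contDiffAt hnhds)
        (by filter_upwards [hnhds] with y hy using hfin y hy) hgrad ω) (by rw [heq]; ring)
    rw [velocity, hmin]
    rfl
  -- The velocity equals a continuous function almost everywhere, so the integral equation gives the
  -- derivative at every time. The cutoff `max s 0` makes this function continuous on the whole
  -- line.
  set c : ℝ → Vec N := fun s => P.closedLoop P.v (x (max s 0)) with hc
  have hcc : Continuous c := by
    rw [← continuousOn_univ]
    refine hcont.comp (h.1.continuousOn.comp (by fun_prop) fun s _ => mem_Ici.2 (le_max_right _ _)) ?_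
    intro s _
    exact hxU _ (le_max_right _ _)
  have hint : ∀ s, 0 ≤ s → x s = x₀ + ∫ τ in (0 : ℝ)..s, c τ := by
    intro s hs
    rw [h.1.eq_integral s hs]
    congr 1
    refine intervalIntegral.integral_congr_ae ?_
    filter_upwards [hae] with τ hτ hτ'
    rw [uIoc_of_le hs] at hτ'
    simp only [hc, max_eq_left hτ'.1.le]
    exact hτ hτ'.1
  have hd := (hcc.integral_hasStrictDerivAt 0 t).hasDerivAt.const_add x₀
  have hct : c t = P.closedLoop P.v (x t) := by simp only [hc, max_eq_left ht]
  rw [hct] at hd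
  exact hd.hasDerivWithinAt.congr (fun s hs => hint s hs) (hint t ht)

end ControlProblem

/-! ### Cutoffs, Grönwall in a tube, global solvability -/

section Analysis

variable {E G : Type*} [NormedAddCommGroup E] [NormedSpace ℝ E]
  [NormedAddCommGroup G] [NormedSpace ℝ G]

/-- A `C¹` function on an open set agrees on a given compact subset with a compactly supported
`C¹` function on the whole space. -/
theorem exists_contDiff_hasCompactSupport_eqOn [FiniteDimensional ℝ E] {F : E → G} {U K : Set E}
    (hU : IsOpen U) (hK : IsCompact K) (hKU : K ⊆ U) (hF : ContDiffOn ℝ 1 F U) :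
    ∃ F' : E → G, ContDiff ℝ 1 F' ∧ HasCompactSupport F' ∧ EqOn F' F K := by
  obtain ⟨K', hK', hKK', hK'U⟩ := exists_compact_between hK hU hKU
  obtain ⟨χ, hχ1, hχ0, -⟩ := exists_contMDiffMap_one_nhds_of_subset_interior (n := 1)
    (modelWithCornersSelf ℝ E) hK.isClosed hKK'
  have hχ : ContDiff ℝ 1 χ := χ.contMDiff.contDiff
  refine ⟨fun x => χ x • F x, contDiff_iff_contDiffAt.2 fun x => ?_, ?_, fun x hx => ?_⟩
  · by_cases hx : x ∈ U
    · exact hχ.contDiffAt.smul (hF.contDiffAt (hU.mem_nhds hx))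
    · have : (fun x => χ x • F x) =ᶠ[𝓝 x] fun _ => 0 := by
        filter_upwards [hK'.isClosed.isOpen_compl.mem_nhds fun h => hx (hK'U h)] with y hy
        rw [hχ0 y hy, zero_smul]
      exact contDiffAt_const.congr_of_eventuallyEq this
  · exact HasCompactSupport.intro hK' fun x hx => by rw [hχ0 x hx, zero_smul]
  · change χ x • F x = F x
    rw [hχ1.self_of_nhdsSet x hx, one_smul]

/-- A Grönwall estimate that needs the differential inequality only while the two curves stay
in a tube of radius `ρ` about each other. -/
theorem norm_sub_le_of_tube {y z y' z' : ℝ → E} {T L ε η ρ : ℝ} (hT : 0 ≤ T) (hL : 0 ≤ L)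
    (hε : 0 ≤ ε) (hη : 0 ≤ η) (hy : ContinuousOn y (Icc 0 T))
    (hy' : ∀ t ∈ Ico 0 T, HasDerivWithinAt y (y' t) (Ici t) t) (hz : ContinuousOn z (Icc 0 T))
    (hz' : ∀ t ∈ Ico 0 T, HasDerivWithinAt z (z' t) (Ici t) t) (h0 : ‖y 0 - z 0‖ ≤ η)
    (hρ : (η + ε * T) * Real.exp (L * T) < ρ)
    (hb : ∀ t ∈ Ico 0 T, ‖y t - z t‖ ≤ ρ → ‖y' t - z' t‖ ≤ L * ‖y t - z t‖ + ε) :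
    ∀ t ∈ Icc 0 T, ‖y t - z t‖ ≤ (η + ε * T) * Real.exp (L * T) := by
  intro t ht
  -- The comparison theorem needs a strict inequality at contact times, provided by `θ`. There `‖y -
  -- z‖` equals `B s ≤ B T ≤ ρ`, so the tube hypothesis applies.
  have key : ∀ θ > 0, (η + (ε + θ) * T) * Real.exp (L * T) ≤ ρ →
      ‖y t - z t‖ ≤ (η + (ε + θ) * T) * Real.exp (L * T) := by
    intro θ hθ hle
    let B : ℝ → ℝ := fun t => (η + (ε + θ) * t) * Real.exp (L * t)
    let B' : ℝ → ℝ := fun t => (ε + θ) * Real.exp (L * t) + L * B t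
    have hB : ∀ t, HasDerivAt B (B' t) t := by
      intro t
      have h1 : HasDerivAt (fun t => η + (ε + θ) * t) (ε + θ) t := by
        have := ((hasDerivAt_id t).const_mul (ε + θ)).const_add η
        rwa [mul_one] at this
      have h2 : HasDerivAt (fun t => Real.exp (L * t)) (Real.exp (L * t) * L) t := by
        have := ((hasDerivAt_id t).const_mul L).exp
        rwa [mul_one] at this
      refine (h1.mul h2).congr_deriv ?_
      simp only [B', B]
      ring
    have hmono : ∀ s ∈ Icc 0 T, B s ≤ B T := by
      intro s hs
      have hs0 := hs.1
      have hsT := hs.2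
      simp only [B]
      gcongr
    have := image_norm_le_of_norm_deriv_right_lt_deriv_boundary' (f := fun t => y t - z t)
      (f' := fun t => y' t - z' t) (B := B) (B' := B') (hy.sub hz)
      (fun t ht => (hy' t ht).sub (hz' t ht)) (by simpa [B] using h0)
      (fun t _ => (hB t).continuousAt.continuousWithinAt)
      (fun t _ => (hB t).hasDerivWithinAt) (fun s hs hsB => by
        have h1 := hb s hs (hsB.trans_le ((hmono s ⟨hs.1, hs.2.le⟩).trans hle))
        refine h1.trans_lt ?_
        rw [hsB]
        have h2 : 1 ≤ Real.exp (L * s) := Real.one_le_exp (mul_nonneg hL hs.1)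
        simp only [B']
        nlinarith) ht
    exact this.trans (hmono t ht)
  have hlim : Tendsto (fun θ : ℝ => (η + (ε + θ) * T) * Real.exp (L * T)) (𝓝[>] 0)
      (𝓝 ((η + ε * T) * Real.exp (L * T))) := by
    have hc : Continuous (fun θ : ℝ => (η + (ε + θ) * T) * Real.exp (L * T)) := by fun_prop
    have := hc.tendsto 0
    rw [add_zero] at this
    exact this.mono_left nhdsWithin_le_nhds
  refine ge_of_tendsto hlim ?_
  filter_upwards [hlim.eventually_le_const hρ, self_mem_nhdsWithin] with θ h1 h2
  exact key θ h2 h1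

/-- A bounded Lipschitz vector field has solutions on every interval `[0, T]`. -/
theorem exists_hasDerivWithinAt_of_lipschitzWith [CompleteSpace E] {F : E → E} {K : NNReal}
    (hF : LipschitzWith K F) {b : ℝ} (hb : ∀ x, ‖F x‖ ≤ b) {T : ℝ} (hT : 0 ≤ T) (x₀ : E) :
    ∃ x : ℝ → E, x 0 = x₀ ∧ ∀ t ∈ Icc 0 T, HasDerivWithinAt x (F (x t)) (Icc 0 T) t := by
  have hb0 : 0 ≤ b := (norm_nonneg _).trans (hb x₀)
  have hPL : IsPicardLindelof (fun _ : ℝ => F) (tmin := 0) (tmax := T) ⟨0, le_rfl, hT⟩ x₀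
      (⟨b * T, mul_nonneg hb0 hT⟩ : NNReal) 0 (⟨b, hb0⟩ : NNReal) K :=
    { lipschitzOnWith := fun _ _ => hF.lipschitzOnWith
      continuousOn := fun _ _ => continuousOn_const
      norm_le := fun _ _ x _ => hb x
      mul_max_le := by
        simp only [sub_zero, sub_self, max_eq_left hT, NNReal.coe_zero]
        exact le_rfl }
  exact hPL.exists_eq_forall_mem_Icc_hasDerivWithinAt₀

end Analysis

/-! ### Greedy data and the set of optimal states -/

namespace ControlProblem

variable {N M : ℕ} {P : ControlProblem N M}

theorem GreedyReachable.zero_mem {A D : Set (Vec N)} {tol ε : ℝ}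
    (h : P.GreedyReachable A tol D ε) : (0 : Vec N) ∈ D := by
  induction h with
  | init => rfl
  | step _ _ _ _ _ ih => exact Or.inl ih

theorem GreedyReachable.eq_zero_or_exists {A D : Set (Vec N)} {tol ε : ℝ}
    (h : P.GreedyReachable A tol D ε) {y : Vec N} (hy : y ∈ D) :
    y = 0 ∨ ∃ x₀ ∈ A, ∃ x u, P.IsOptimal x₀ x u ∧ x '' Ici 0 ⊆ D ∧ ∃ t, 0 ≤ t ∧ x t = y := by
  induction h with
  | init => exact Or.inl hy
  | step _ _ mem _ optimal ih =>
    rcases hy with hy | ⟨t, ht, rfl⟩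
    · rcases ih hy with h | ⟨x₀, h1, x, u, h2, h3, h4⟩
      · exact Or.inl h
      · exact Or.inr ⟨x₀, h1, x, u, h2, h3.trans subset_union_left, h4⟩
    · exact Or.inr ⟨_, mem, _, _, optimal, subset_union_right, t, ht, rfl⟩

/-- The final `ε` is the maximal distance to the set before its last enlargement, and enlarging only
decreases distances. The initial value `tol + 1` rules out stopping without a step. -/
theorem IsGreedyOutput.infDist_le {A D : Set (Vec N)} {tol : ℝ}
    (h : P.IsGreedyOutput A tol D) {y : Vec N} (hy : y ∈ A) : Metric.infDist y D ≤ tol := by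
  obtain ⟨ε, hr, hε⟩ := h
  cases hr with
  | init => linarith
  | step prev _ _ argmax _ =>
    exact (Metric.infDist_le_infDist_of_subset subset_union_left ⟨0, prev.zero_mem⟩).trans
      ((argmax y hy).trans hε)

theorem subset_optimalStates {A : Set (Vec N)} (hopt : ∀ x₀ ∈ A, ∃ x u, P.IsOptimal x₀ x u) :
    A ⊆ P.optimalStates A := by
  intro x₀ hx₀
  obtain ⟨x, u, h⟩ := hopt x₀ hx₀
  exact subset_closure ⟨x₀, hx₀, x, u, h, 0, le_rfl, h.1.initial⟩

theorem IsOptimal.mem_optimalStates {A : Set (Vec N)} {x₀ : Vec N} (hx₀ : x₀ ∈ A)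
    {x : ℝ → Vec N} {u : ℝ → Vec M} (h : P.IsOptimal x₀ x u) {t : ℝ} (ht : 0 ≤ t) :
    x t ∈ P.optimalStates A :=
  subset_closure ⟨x₀, hx₀, x, u, h, t, ht, rfl⟩

/-- The value does not increase along optimal trajectories, so all their states lie in one sublevel
set, which is bounded by radial unboundedness. -/
theorem isCompact_optimalStates {A : Set (Vec N)} (hA : IsCompact A)
    (hfin : ∀ x ∈ A, P.value x ≠ ⊤) (hv : ContinuousOn P.v A)
    (hrad : Tendsto P.value (cocompact (Vec N)) (𝓝 ⊤)) : IsCompact (P.optimalStates A) := by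
  obtain ⟨m, hm⟩ := hA.bddAbove_image hv
  have hev : ∀ᶠ x in cocompact (Vec N), ENNReal.ofReal m < P.value x :=
    hrad.eventually (lt_mem_nhds ENNReal.ofReal_lt_top)
  obtain ⟨S, hS, hSsub⟩ := mem_cocompact.1 hev
  refine hS.of_isClosed_subset isClosed_closure (closure_minimal ?_ hS.isClosed)
  rintro y ⟨x₀, hx₀, x, u, hopt, t, ht, rfl⟩
  by_contra hy
  refine not_le.2 (hSsub hy) ((hopt.value_le ht).trans ?_)
  rw [← ENNReal.ofReal_toReal (hfin x₀ hx₀)]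
  exact ENNReal.ofReal_le_ofReal (hm ⟨x₀, hx₀, rfl⟩)

/-- Otherwise `r` has a positive minimum on the compact set of optimal states and the cost is
infinite. The result is needed because the greedy data start with 0. -/
theorem zero_mem_optimalStates {A : Set (Vec N)} (hc : IsCompact (P.optimalStates A))
    {x₀ : Vec N} (hx₀ : x₀ ∈ A) (hfin : P.value x₀ ≠ ⊤) {x : ℝ → Vec N} {u : ℝ → Vec M}
    (h : P.IsOptimal x₀ x u) : (0 : Vec N) ∈ P.optimalStates A := by
  by_contra h0
  obtain ⟨y, hy, hmin⟩ := hc.exists_isMinOn ⟨x 0, h.mem_optimalStates hx₀ le_rfl⟩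
    P.r_continuous.continuousOn
  have hpos : 0 < P.r y := lt_of_le_of_ne (P.r_nonneg y) fun he =>
    h0 ((P.r_eq_zero_iff y).1 he.symm ▸ hy)
  refine hfin (top_le_iff.1 ?_)
  rw [← h.2, cost_eq]
  calc (⊤ : ℝ≥0∞) = ∫⁻ _ in Ici (0 : ℝ), ENNReal.ofReal (P.r y) := by
        rw [setLIntegral_const, Real.volume_Ici,
          ENNReal.mul_top (ENNReal.ofReal_pos.2 hpos).ne']
    _ ≤ _ := by
        refine setLIntegral_mono' measurableSet_Ici fun s hs => ENNReal.ofReal_le_ofReal ?_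
        have h1 : P.r y ≤ P.r (x s) := hmin (h.mem_optimalStates hx₀ hs)
        exact h1.trans (le_add_of_nonneg_right (P.inner_weight_nonneg _))

/-! ### The closed-loop field and its smooth dependence -/

variable (P)

theorem value_zero : P.value 0 = 0 := by
  refine le_antisymm ?_ bot_le
  have hadm : P.IsAdmissible 0 (fun _ => 0) (fun _ => 0) :=
    ⟨measurable_const, fun t _ => by simp [P.f_zero], fun t _ => by simp [P.f_zero]⟩
  refine (P.value_le_cost hadm).trans_eq ?_
  simp [cost, (P.r_eq_zero_iff 0).2 rfl]

/-- 0 minimizes `v`, so the gradient vanishes there. Hence the initial datum 0 is a constant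
trajectory inside the greedy data. -/
theorem closedLoop_v_zero : P.closedLoop P.v 0 = 0 := by
  have hmin : IsLocalMin P.v 0 := Eventually.of_forall fun x => by
    simp [v, value_zero]
  have : gradient P.v 0 = 0 := by rw [gradient, hmin.fderiv_eq_zero, map_zero]
  simp [closedLoop, this, P.f_zero]

/-- The matrix `-½ g R⁻¹ gᵀ` that maps the costate to the controlled part of the velocity. -/
def feedbackOperator (x : Vec N) : Vec N →L[ℝ] Vec N :=
  LinearMap.toContinuousLinearMap
    (-(1 / 2 : ℝ) • (P.g x * (P.R⁻¹ * (P.g x).transpose)).toEuclideanLin)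

theorem closedLoop_eq (s : Vec N → ℝ) (x : Vec N) :
    P.closedLoop s x = P.f x + P.feedbackOperator x (gradient s x) := by
  rw [closedLoop, feedbackOperator, map_smul, ← toEuclideanLin_mul_apply]
  simp

theorem contDiffOn_feedbackOperator {U : Set (Vec N)}
    (hg : ∀ i j, ContDiffOn ℝ 1 (fun x => P.g x i j) U) :
    ContDiffOn ℝ 1 P.feedbackOperator U := by
  rw [contDiffOn_clm_apply]
  intro p
  rw [contDiffOn_piLp]
  intro i
  simp only [feedbackOperator, LinearMap.coe_toContinuousLinearMap', LinearMap.smul_apply,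
    PiLp.smul_apply, smul_eq_mul, Matrix.toLpLin_apply, Matrix.mulVec, dotProduct,
    Matrix.mul_apply, Matrix.transpose_apply]
  refine contDiffOn_const.mul (ContDiffOn.sum fun j _ => ContDiffOn.mul
    (ContDiffOn.sum fun l _ => (hg i l).mul (ContDiffOn.sum fun m _ => ?_)) contDiffOn_const)
  exact contDiffOn_const.mul (hg j m)

end ControlProblem

theorem ContDiffOn.clm_adjoint {E H X : Type*} [NormedAddCommGroup X] [NormedSpace ℝ X]
    [NormedAddCommGroup E] [InnerProductSpace ℝ E] [CompleteSpace E]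
    [NormedAddCommGroup H] [InnerProductSpace ℝ H] [CompleteSpace H]
    {L : X → E →L[ℝ] H} {U : Set X} {n : WithTop ℕ∞} (hL : ContDiffOn ℝ n L U) :
    ContDiffOn ℝ n (fun x => (L x).adjoint) U := by
  -- Over the reals the conjugate-linear adjoint is a bounded linear map, hence smooth.
  let a : (E →L[ℝ] H) →L[ℝ] (H →L[ℝ] E) := LinearMap.mkContinuous
    { toFun := fun A => A.adjoint
      map_add' := fun A B => map_add _ A B
      map_smul' := fun c A => by simp } 1 fun A => by simp
  exact a.contDiff.comp_contDiffOn hL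

/-! ### Comparison with a trajectory inside the data -/

section Comparison

variable {E : Type*} [NormedAddCommGroup E] [NormedSpace ℝ E]

variable {F F' G G' : E → E} {K S D : Set E} {L : NNReal} {T ρ ε : ℝ}

/-- Solutions of a perturbed equation stay close to a trajectory along which the perturbation
is small. -/
theorem norm_sub_le_of_perturbation (hT : 0 ≤ T) (hF' : LipschitzWith L F')
    (hF : ∀ x ∈ K, F x = F' x) (hK : ∀ x ∈ S, ∀ y, ‖y - x‖ ≤ ρ → y ∈ K) (hρ : 0 ≤ ρ)
    (hDS : D ⊆ S) (hε : 0 ≤ ε) (hFG : ∀ x ∈ D, ‖F x - G x‖ ≤ ε) {η : ℝ} (hη : 0 ≤ η)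
    (hsmall : (η + ε * T) * Real.exp (L * T) < ρ) {y y' z : ℝ → E} (h0 : ‖y 0 - z 0‖ ≤ η)
    (hz : ∀ t, 0 ≤ t → z t ∈ D ∧ HasDerivWithinAt z (G (z t)) (Ici 0) t)
    (hy : ∀ t ∈ Icc 0 T, HasDerivWithinAt y (y' t) (Icc 0 T) t)
    (hy' : ∀ t ∈ Icc 0 T, y t ∈ K → y' t = F' (y t)) :
    ∀ t ∈ Icc 0 T, ‖y t - z t‖ ≤ (η + ε * T) * Real.exp (L * T) := by
  have hzc : ContinuousOn z (Icc 0 T) := fun t ht =>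
    (hz t ht.1).2.continuousWithinAt.mono Icc_subset_Ici_self
  have hzd : ∀ t ∈ Ico 0 T, HasDerivWithinAt z (G (z t)) (Ici t) t := fun t ht =>
    (hz t ht.1).2.mono (Ici_subset_Ici.2 ht.1)
  refine norm_sub_le_of_tube (y' := y') hT L.coe_nonneg hε hη (fun t ht => (hy t ht).continuousWithinAt)
    (fun t ht => ?_) hzc hzd h0 hsmall fun t ht hle => ?_
  · exact (hy t ⟨ht.1, ht.2.le⟩).mono_of_mem_nhdsWithin (Icc_mem_nhdsGE_of_mem ht)
  · have hzD := (hz t ht.1).1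
    have hzK : z t ∈ K := hK _ (hDS hzD) _ (by simpa using hρ)
    rw [hy' t ⟨ht.1, ht.2.le⟩ (hK _ (hDS hzD) _ hle)]
    have h1 := hF'.dist_le_mul (y t) (z t)
    rw [dist_eq_norm, dist_eq_norm] at h1
    have h2 := hFG (z t) hzD
    rw [hF (z t) hzK] at h2
    -- The Lipschitz bound is used for the perturbed field, so the error of the fields is evaluated
    -- only at `z t`, which lies in `D`.
    calc _ = ‖(F' (y t) - F' (z t)) + (F' (z t) - G (z t))‖ := by congr 1; abel
      _ ≤ _ := (norm_add_le _ _).trans (add_le_add h1 h2)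

/-- Well-posedness of a perturbed equation and stability of its solutions, when the perturbation
is small only along trajectories that start near the given initial state. -/
theorem exists_solution_and_norm_sub_le [CompleteSpace E] (hT : 0 ≤ T) (hF' : LipschitzWith L F')
    (hG' : LipschitzWith L G') {b : ℝ} (hb : ∀ x, ‖F' x‖ ≤ b) (hF : ∀ x ∈ K, F x = F' x)
    (hG : ∀ x ∈ K, G x = G' x) (hK : ∀ x ∈ S, ∀ y, ‖y - x‖ ≤ ρ → y ∈ K) (hρ : 0 ≤ ρ)
    (hDS : D ⊆ S) {d : ℝ} (hd : 0 ≤ d) (hε : 0 ≤ ε) (hFG : ∀ x ∈ D, ‖F x - G x‖ ≤ ε) {x₀ : E}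
    (hnear : ∀ η, d < η → ∃ z : ℝ → E, ‖x₀ - z 0‖ ≤ η ∧ ∀ t, 0 ≤ t → z t ∈ D ∧
      HasDerivWithinAt z (G (z t)) (Ici 0) t)
    (hsmall : (d + ε * T) * Real.exp (L * T) < ρ) :
    (∃ y, y 0 = x₀ ∧ ∀ t ∈ Icc 0 T, HasDerivWithinAt y (F (y t)) (Icc 0 T) t) ∧
      ∀ x, x 0 = x₀ → (∀ t, 0 ≤ t → x t ∈ S ∧ HasDerivWithinAt x (G (x t)) (Ici 0) t) →
        ∀ y, (y 0 = x₀ ∧ ∀ t ∈ Icc 0 T, HasDerivWithinAt y (F (y t)) (Icc 0 T) t) →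
          ∀ t ∈ Icc 0 T, ‖x t - y t‖ ≤ (2 * d + ε * T) * Real.exp (L * T) := by
  have hexp : 0 < Real.exp (L * T) := Real.exp_pos _
  -- The distance to the data need not be attained, so trajectories start only at distances above
  -- `d`; the strict inequality `hsmall` leaves room for this excess.
  obtain ⟨gap, hgap, hgapeq⟩ : ∃ gap > 0, gap * Real.exp (L * T) +
      (d + ε * T) * Real.exp (L * T) < ρ := by
    refine ⟨(ρ - (d + ε * T) * Real.exp (L * T)) / (2 * Real.exp (L * T)),
      div_pos (by linarith) (by positivity), ?_⟩
    rw [div_mul_eq_mul_div, mul_div_mul_right _ _ hexp.ne']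
    linarith
  have hη : ∀ ζ, ζ ≤ gap → (d + ζ + ε * T) * Real.exp (L * T) < ρ := by
    intro ζ hζ
    have : ζ * Real.exp (L * T) ≤ gap * Real.exp (L * T) := by gcongr
    linarith
  constructor
  · obtain ⟨z, hz0, hz⟩ := hnear (d + gap) (by linarith)
    -- The globally defined field `F'` has a solution; the estimate confines it to `K`, where `F'`
    -- equals `F`.
    obtain ⟨y, hy0, hy⟩ := exists_hasDerivWithinAt_of_lipschitzWith hF' hb hT x₀
    have hyz := norm_sub_le_of_perturbation hT hF' hF hK hρ hDS hε hFG (by positivity)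
      (hη gap le_rfl) (by rwa [hy0]) hz hy fun _ _ _ => rfl
    refine ⟨y, hy0, fun t ht => ?_⟩
    rw [hF (y t) (hK _ (hDS (hz t ht.1).1) _ ((hyz t ht).trans (hη gap le_rfl).le))]
    exact hy t ht
  · intro x hx0 hx y hy t ht
    refine le_of_forall_pos_le_add fun κ hκ => ?_
    set ζ := min gap (κ / (2 * Real.exp (L * T))) with hζ
    have hζ0 : 0 < ζ := lt_min hgap (by positivity)
    have hsm := hη ζ (min_le_left _ _)
    obtain ⟨z, hz0, hz⟩ := hnear (d + ζ) (by linarith)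
    have h1 := norm_sub_le_of_perturbation hT hF' hF hK hρ hDS hε hFG (by positivity) hsm
      (by rwa [hy.1]) hz hy.2 (fun t _ h => hF _ h) t ht
    have hsm0 : (d + ζ + 0 * T) * Real.exp (L * T) < ρ := by
      refine lt_of_le_of_lt ?_ hsm
      gcongr
    -- Both `x` and `z` follow `G`, so only the initial distance contributes.
    have h2 := norm_sub_le_of_perturbation (F := G) hT hG' hG hK hρ hDS le_rfl
      (fun x _ => by simp) (by positivity) hsm0 (by rwa [hx0]) hz
      (fun t ht => (hx t ht.1).2.mono Icc_subset_Ici_self) (fun t _ h => hG _ h) t ht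
    have h3 : ζ * Real.exp (L * T) ≤ κ / 2 := by
      calc ζ * Real.exp (L * T) ≤ κ / (2 * Real.exp (L * T)) * Real.exp (L * T) := by
            gcongr
            exact min_le_right _ _
        _ = κ / 2 := by field_simp
    calc ‖x t - y t‖ ≤ ‖x t - z t‖ + ‖z t - y t‖ := norm_sub_le_norm_sub_add_norm_sub _ _ _
      _ ≤ _ := by rw [norm_sub_rev (z t)]; linarith

end Comparison

/-! ### Uniform stability constants -/

namespace ControlProblem

variable {N M : ℕ} {P : ControlProblem N M}

theorem add_mem_interior_dilatedStates {A : Set (Vec N)} {δ : ℝ} {x w : Vec N}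
    (hx : x ∈ P.optimalStates A) (hw : ‖w‖ < δ) : x + w ∈ interior (P.dilatedStates A δ) := by
  have hsub : P.optimalStates A + Metric.ball (0 : Vec N) δ ⊆ P.dilatedStates A δ :=
    add_subset_add_left Metric.ball_subset_closedBall
  exact interior_maximal hsub Metric.isOpen_ball.add_left
    (add_mem_add hx (by simpa using hw))

/-- Every state collected by the greedy exploration is the initial state of a solution of the
optimally controlled system that consists of collected states. -/
theorem IsGreedyOutput.exists_trajectory {A D : Set (Vec N)} {tol : ℝ}
    (h : P.IsGreedyOutput A tol D)
    (hode : ∀ x₀ ∈ A, ∀ x u, P.IsOptimal x₀ x u → ∀ t, 0 ≤ t →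
      HasDerivWithinAt x (P.closedLoop P.v (x t)) (Ici 0) t) {y : Vec N} (hy : y ∈ D) :
    ∃ z : ℝ → Vec N, z 0 = y ∧ ∀ t, 0 ≤ t → z t ∈ D ∧
      HasDerivWithinAt z (P.closedLoop P.v (z t)) (Ici 0) t := by
  obtain ⟨ε, hr, -⟩ := h
  rcases hr.eq_zero_or_exists hy with rfl | ⟨x₀, hx₀, x, u, hopt, hsub, t, ht, rfl⟩
  · refine ⟨fun _ => 0, rfl, fun t _ => ⟨hr.zero_mem, ?_⟩⟩
    rw [P.closedLoop_v_zero]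
    exact hasDerivWithinAt_const _ _ _
  · refine ⟨fun s => x (s + t), by simp, fun s hs => ⟨hsub ⟨s + t, add_nonneg hs ht, rfl⟩, ?_⟩⟩
    have h1 := hode x₀ hx₀ x u hopt (s + t) (add_nonneg hs ht)
    have h2 : HasDerivWithinAt (fun s => s + t) 1 (Ici 0) s :=
      ((hasDerivAt_id s).add_const t).hasDerivWithinAt
    have h3 := h1.scomp (t' := Ici 0) (h := fun s => s + t) s h2
      fun τ hτ => add_nonneg (mem_Ici.1 hτ) ht
    rwa [one_smul] at h3

end ControlProblem

open ControlProblem in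
theorem exists_stability_constants {N M : ℕ} (P : ControlProblem N M) {A : Set (Vec N)}
    (hA : IsCompact A) (hopt : ∀ x₀ ∈ A, ∃ x u, P.IsOptimal x₀ x u) {δ : ℝ} (hδ : 0 < δ)
    {k : Vec N → Vec N → ℝ} (hk : RKHSAssumption P (P.dilatedStates A δ) k)
    (hf : ContDiffOn ℝ 1 P.f (P.dilatedStates A δ))
    (hg : ∀ i j, ContDiffOn ℝ 1 (fun x => P.g x i j) (P.dilatedStates A δ)) {T : ℝ}
    (hT : 0 < T) (hne : A.Nonempty) :
    ∃ b > 0, ∃ L ≥ 0, ∀ εd εf : ℝ, 0 ≤ εd → 0 ≤ εf →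
      (εd + b * εf * T) * Real.exp (L * T) < δ / 2 →
      ∀ D, P.IsGreedyOutput A εd D → ∀ s, IsVKOGAOutput k P.v D εf s → ∀ x₀ ∈ A,
        (∃ xs, P.IsSurrogateTrajectory s T x₀ xs) ∧
        ∀ x u, P.IsOptimal x₀ x u → ∀ xs, P.IsSurrogateTrajectory s T x₀ xs →
          ∀ t ∈ Icc 0 T, ‖x t - xs t‖ ≤ (2 * εd + b * εf * T) * Real.exp (L * T) := by
  set Ω := P.dilatedStates A δ with hΩ
  set U := interior Ω with hUdef
  have hUo : IsOpen U := isOpen_interior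
  obtain ⟨H, i1, i2, i3, Φ, h, hΦ, hin, hv⟩ := hk.mem.exists_featureMap hk.smooth
  have hΦd : DifferentiableOn ℝ Φ U := hΦ.differentiableOn (by norm_num)
  have hgrad : ∀ {φ : Vec N → ℝ} {h' : H}, (∀ x ∈ Ω, φ x = inner ℝ (Φ x) h') → ∀ x ∈ U,
      HasGradientAt φ ((fderiv ℝ Φ x).adjoint h') x := fun hφ x hx =>
    gradient_eq_adjoint_fderiv hφ hx (hΦd.differentiableAt (hUo.mem_nhds hx))
  have hfU : ContDiffOn ℝ 1 P.f U := hf.mono interior_subset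
  have hgU : ∀ i j, ContDiffOn ℝ 1 (fun x => P.g x i j) U := fun i j =>
    (hg i j).mono interior_subset
  have hBU := P.contDiffOn_feedbackOperator hgU
  set S := P.optimalStates A with hS
  have hAS : A ⊆ S := subset_optimalStates hopt
  have htube : ∀ x ∈ S, ∀ w : Vec N, ‖w‖ < δ → x + w ∈ U := fun x hx w hw =>
    add_mem_interior_dilatedStates hx hw
  have hSU : S ⊆ U := fun x hx => by simpa using htube x hx 0 (by simpa using hδ)
  have hvd : DifferentiableOn ℝ P.v U := fun x hx =>
    (hgrad hv x hx).hasFDerivAt.differentiableAt.differentiableWithinAt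
  have hfinU : ∀ x ∈ U, P.value x ≠ ⊤ := fun x hx => hk.finite x (interior_subset hx)
  have hfinA : ∀ x ∈ A, P.value x ≠ ⊤ := fun x hx => hfinU x (hSU (hAS hx))
  have hSc : IsCompact S := isCompact_optimalStates hA hfinA
    (hvd.continuousOn.mono (hAS.trans hSU)) hk.radially_unbounded
  have h0S : (0 : Vec N) ∈ S := by
    obtain ⟨x₀, hx₀⟩ := hne
    obtain ⟨x, u, hxu⟩ := hopt x₀ hx₀
    exact zero_mem_optimalStates hSc hx₀ (hfinA x₀ hx₀) hxu
  -- the closed-loop field is affine in the representer of the surrogate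
  let C : Vec N → H →L[ℝ] Vec N := fun x =>
    (P.feedbackOperator x).comp (fderiv ℝ Φ x).adjoint
  have hC : ContDiffOn ℝ 1 C U :=
    hBU.clm_comp (ContDiffOn.clm_adjoint (hΦ.fderiv_of_isOpen hUo (by norm_num)))
  have hloop : ∀ {φ : Vec N → ℝ} {h' : H}, (∀ x ∈ Ω, φ x = inner ℝ (Φ x) h') → ∀ x ∈ U,
      P.closedLoop φ x = P.f x + C x h' := fun hφ x hx => by
    rw [P.closedLoop_eq, (hgrad hφ x hx).gradient]
    rfl
  have hloopc : ContinuousOn (P.closedLoop P.v) U :=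
    (hfU.continuousOn.add (hC.continuousOn.clm_apply continuousOn_const)).congr
      fun x hx => hloop hv x hx
  have hode : ∀ x₀ ∈ A, ∀ x u, P.IsOptimal x₀ x u → ∀ t, 0 ≤ t →
      HasDerivWithinAt x (P.closedLoop P.v (x t)) (Ici 0) t := fun x₀ hx₀ x u hxu t ht =>
    hxu.hasDerivWithinAt (hfinA x₀ hx₀) hUo
      (fun τ hτ => hSU (hxu.mem_optimalStates hx₀ hτ)) hfU hgU hfinU hvd hloopc ht
  -- global Lipschitz extensions from the tube of radius `δ / 2`
  set K := S + Metric.closedBall (0 : Vec N) (δ / 2) with hK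
  have hKc : IsCompact K := hSc.add (isCompact_closedBall 0 (δ / 2))
  have hKU : K ⊆ U := by
    rintro _ ⟨x, hx, w, hw, rfl⟩
    refine htube x hx w ?_
    have : ‖w‖ ≤ δ / 2 := by simpa using hw
    linarith
  have hmemK : ∀ x ∈ S, ∀ y, ‖y - x‖ ≤ δ / 2 → y ∈ K := fun x hx y hy =>
    ⟨x, hx, y - x, by simpa using hy, add_sub_cancel x y⟩
  obtain ⟨f', hf'1, hf'2, hf'3⟩ := exists_contDiff_hasCompactSupport_eqOn hUo hKc hKU hfU
  obtain ⟨C', hC'1, hC'2, hC'3⟩ := exists_contDiff_hasCompactSupport_eqOn hUo hKc hKU hC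
  obtain ⟨Lf, hLf⟩ := ContDiff.lipschitzWith_of_hasCompactSupport (𝕂 := ℝ) hf'2 hf'1 (by norm_num)
  obtain ⟨LC, hLC⟩ := ContDiff.lipschitzWith_of_hasCompactSupport (𝕂 := ℝ) hC'2 hC'1 (by norm_num)
  obtain ⟨bf, hbf⟩ := hf'2.exists_bound_of_continuous hf'1.continuous
  obtain ⟨bC, hbC⟩ := hC'2.exists_bound_of_continuous hC'1.continuous
  obtain ⟨bB, hbB⟩ := hSc.exists_bound_of_continuousOn (hBU.continuousOn.mono hSU)
  -- A single Lipschitz constant for all surrogates, because their representers satisfy `‖h'‖ ≤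
  -- ‖h‖`.
  set L : NNReal := Lf + LC * ‖h‖₊ with hL
  have hLip : ∀ h' : H, ‖h'‖ ≤ ‖h‖ → LipschitzWith L fun x => f' x + C' x h' := by
    intro h' hh'
    refine hLf.add (LipschitzWith.of_dist_le_mul fun x y => ?_)
    rw [dist_eq_norm, ← sub_apply]
    refine ((C' x - C' y).le_opNorm h').trans ?_
    rw [NNReal.coe_mul, coe_nnnorm, mul_right_comm, ← dist_eq_norm]
    gcongr
    exact hLC.dist_le_mul x y
  have hloopK : ∀ {φ : Vec N → ℝ} {h' : H}, (∀ x ∈ Ω, φ x = inner ℝ (Φ x) h') → ∀ x ∈ K,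
      P.closedLoop φ x = f' x + C' x h' := fun hφ x hx => by
    rw [hloop hφ x (hKU hx), hf'3 hx, hC'3 hx]
  -- The maximum with 1 keeps the constant positive even if the feedback operator vanishes on `S`.
  refine ⟨max bB 1, by positivity, L, L.coe_nonneg, ?_⟩
  intro εd εf hεd hεf hsmall D hD s hs x₀ hx₀
  set b := max bB 1 with hb
  have hDS : D ⊆ S := by
    obtain ⟨ε, hr, -⟩ := hD
    intro y hy
    rcases hr.eq_zero_or_exists hy with rfl | ⟨x₁, hx₁, x, u, hxu, -, t, ht, rfl⟩
    · exact h0S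
    · exact hxu.mem_optimalStates hx₁ ht
  obtain ⟨h', hh', hrep⟩ : ∃ h' : H, ‖h'‖ ≤ ‖h‖ ∧ ∀ x ∈ Ω, s x = inner ℝ (Φ x) h' := by
    obtain ⟨X, hX, -⟩ := hs
    exact hX.isHermiteInterpolant.exists_representer hin hΦd hv
      (hX.subset.trans (hDS.trans hSU))
  have hdiff : ∀ x ∈ D, ‖P.closedLoop s x - P.closedLoop P.v x‖ ≤ b * εf := by
    intro x hx
    rw [P.closedLoop_eq, P.closedLoop_eq, add_sub_add_left_eq_sub, ← map_sub]
    refine ((P.feedbackOperator x).le_opNorm _).trans ?_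
    have h1 : ‖gradient s x - gradient P.v x‖ ≤ εf := by
      rw [norm_sub_rev]
      exact (le_add_of_nonneg_left (abs_nonneg _)).trans (hs.hermiteError_le hεf hx)
    exact mul_le_mul ((hbB x (hDS hx)).trans (le_max_left _ _)) h1 (norm_nonneg _) (by positivity)
  refine exists_solution_and_norm_sub_le (F' := fun x => f' x + C' x h')
    (G' := fun x => f' x + C' x h) (K := K) (S := S) (D := D) hT.le (hLip h' hh') (hLip h le_rfl)
    (b := bf + bC * ‖h'‖) (fun x => (norm_add_le _ _).trans (add_le_add (hbf x)
      ((C' x).le_of_opNorm_le (hbC x) h'))) (hloopK hrep) (hloopK hv) hmemK (by positivity) hDS hεd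
    (by positivity) hdiff ?_ hsmall |>.imp id
      fun H x u hxu => H x hxu.1.initial fun t ht => ⟨hxu.mem_optimalStates hx₀ ht,
        hode x₀ hx₀ x u hxu t ht⟩
  intro η hη
  have hDne : D.Nonempty := by
    obtain ⟨ε, hr, -⟩ := hD
    exact ⟨0, hr.zero_mem⟩
  obtain ⟨y, hy, hlt⟩ := (Metric.infDist_lt_iff hDne).1 ((hD.infDist_le hx₀).trans_lt hη)
  obtain ⟨z, hz0, hz⟩ := hD.exists_trajectory hode hy
  refine ⟨z, ?_, hz⟩
  rw [hz0, ← dist_eq_norm]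
  exact hlt.le

end HermiteControl

end

theorem mainTheorem2 {N M : ℕ} (P : HermiteControl.ControlProblem N M)
    (A : Set (HermiteControl.Vec N)) (hA : IsCompact A)
    (hopt : ∀ x₀ ∈ A, ∃ x u, P.IsOptimal x₀ x u)
    (δ : ℝ) (hδ : 0 < δ)
    (k : HermiteControl.Vec N → HermiteControl.Vec N → ℝ)
    (hk : HermiteControl.RKHSAssumption P (P.dilatedStates A δ) k)
    (hf : ContDiffOn ℝ 1 P.f (P.dilatedStates A δ))
    (hg : ∀ i j, ContDiffOn ℝ 1 (fun x => P.g x i j) (P.dilatedStates A δ)) :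
    ∀ T : ℝ, 0 < T → ∃ Cd : ℝ, 0 < Cd ∧ ∃ Cf : ℝ, 0 < Cf ∧
      ∀ εd εf : ℝ, 0 ≤ εd → 0 ≤ εf → εd * Cd + εf * Cf < δ →
      ∀ D : Set (HermiteControl.Vec N), P.IsGreedyOutput A εd D →
      ∀ s : HermiteControl.Vec N → ℝ, HermiteControl.IsVKOGAOutput k P.v D εf s →
      ∀ x₀ ∈ A,
        (∃ xs, P.IsSurrogateTrajectory s T x₀ xs) ∧
        ∀ x u, P.IsOptimal x₀ x u → ∀ xs, P.IsSurrogateTrajectory s T x₀ xs →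
          ∀ t ∈ Set.Icc 0 T, ‖x t - xs t‖ ≤ εd * Cd + εf * Cf := by
  intro T hT
  -- For empty `A` there are no optimal states, so 0 is not among them.
  rcases A.eq_empty_or_nonempty with rfl | hne
  · exact ⟨1, one_pos, 1, one_pos, fun _ _ _ _ _ _ _ _ _ x₀ hx₀ => absurd hx₀ (by simp)⟩
  obtain ⟨b, hb, L, hL, hmain⟩ :=
    HermiteControl.exists_stability_constants P hA hopt hδ hk hf hg hT hne
  -- The 2 in the first constant also absorbs the two comparisons of initial states; the 2 in the
  -- second turns the bound by `δ` into the bound by the tube radius `δ / 2`.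
  refine ⟨2 * Real.exp (L * T), by positivity, 2 * b * T * Real.exp (L * T), by positivity, ?_⟩
  intro εd εf hεd hεf hsmall D hD s hs x₀ hx₀
  obtain ⟨h1, h2⟩ := hmain εd εf hεd hεf (by linarith) D hD s hs x₀ hx₀
  refine ⟨h1, fun x u hxu xs hxs t ht => (h2 x u hxu xs hxs t ht).trans ?_⟩
  have : 0 ≤ b * εf * T * Real.exp (L * T) := by positivity
  linarith
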